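/- Let $\mathbb O=\mathbb H\oplus\mathbb H$ be the octonions with product $(q_1,q_2)(p_1,p_2)=(q_1p_1-\bar p_2q_2,\;p_2q_1+q_2\bar p_1)$, conjugation $\overline{(q_1,q_2)}=(\bar q_1,-q_2)$, inner product $\langle x,y\rangle=\mathrm{Re}(x\bar y)$ and $|x|^2=\langle x,x\rangle$. Put $$U_1=\{(1,u,v)\in\mathbb O^3: 1+|u|^2-|v|^2>0\},\qquad U_2=\{(u,1,v)\in\mathbb O^3: |u|^2+1-|v|^2>0\}.$$ The relation $(a,b,c)\sim(d,e,f)\iff a=d\lambda,\ b=e\lambda,\ c=f\lambda$ for some $\lambda\in\mathbb O\setminus\{0\}$ is an equivalence relation on $U_1\cup U_2$. The indefinite octonionic projective plane is $\mathbb OP^{(1,1)}=(U_1\cup U_2)/\!\sim$, with the quotient topology and the smooth structure given by the two charts $[1,u,v]\mapsto(u,v)$ on $U_1/\!\sim$ and $[u,1,v]\mapsto(u,v)$ on $U_2/\!\sim$. Its metric $g$ is given in both charts by $$ds^2=\frac{|du|^2(1-|v|^2)-|dv|^2(1+|u|^2)+2\,\mathrm{Re}[(u\bar v)(dv\,d\bar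 u)]}{(1+|u|^2-|v|^2)^2}.$$ Let $R$ be its Riemann curvature tensor, with the sign convention $R(x,y)=\nabla_{[x,y]}-[\nabla_x,\nabla_y]$, let $\mathcal J_v(x)=R(v,x)v$ be the Jacobi operator, write $\varepsilon_v=g(v,v)$, and call a tangent vector $v$ unit if $\varepsilon_v=\pm1$. **Theorem.** The two chart expressions agree on the overlap and define a smooth non-degenerate metric $g$ of signature $(8,8)$ on $\mathbb OP^{(1,1)}$, and $(\mathbb OP^{(1,1)},g)$ is a special Osserman manifold. That is, with $\lambda=4$ and $\mu=1$, the following hold at every point $P$, for all $v,w\in T_P\mathbb OP^{(1,1)}$ with $v$ unit: 1. $\mathcal J_v$ maps $v^\perp$ to itself, is diagonalizable there, and its non-zero eigenvalues on $v^\perp$ are exactly $\varepsilon_v\lambda$ and $\varepsilon_v\mu$; 2. with $E_\lambda(v)=\mathrm{span}\{v\}\oplus\ker(\mathcal J_v-\varepsilon_v\lambda\,\mathrm{Id})$: if $w$ is unit and $w\in E_\lambda(v)$, then $E_\lambda(w)=E_\lambda(v)$; 3. if $w\in\ker(\mathcal J_v-\varepsilon_v\mu\,\mathrm{Id})$, then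 $v\in\ker(\mathcal J_w-\varepsilon_w\mu\,\mathrm{Id})$. Moreover the eigenvalues $4\varepsilon_v$ and $\varepsilon_v$ have multiplicities $7$ and $8$. Finally, identify the tangent space at $P_0=[1,0,0]$ with $\mathbb O^2$ by the first chart. For a unit vector $(a,b)$ at $P_0$, $$\ker(\mathcal J_{(a,b)}-4\varepsilon_{(a,b)}\mathrm{Id})=\begin{cases}\big\{\big(c,\tfrac1{|a|^2}(b\bar a)c\big): c\in\mathbb O,\ c\perp a\big\}&\text{if }|a|\neq0,\\[1ex]\big\{\big(\tfrac1{|b|^2}(a\bar b)d,d\big): d\in\mathbb O,\ d\perp b\big\}&\text{if }|b|\neq0,\end{cases}$$ $$\ker(\mathcal J_{(a,b)}-\varepsilon_{(a,b)}\mathrm{Id})=\begin{cases}\big\{\big(\tfrac1{|a|^2}(a\bar b)d,d\big): d\in\mathbb O\big\}&\text{if }|a|\neq0,\\[1ex]\big\{\big(c,\tfrac1{|b|^2}(b\bar a)c\big): c\in\mathbb O\big\}&\text{if }|b|\neq0,\end{cases}$$ where both descriptions are valid when $a$ and $b$ are both non-zero. -/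

import Mathlib

set_option maxSynthPendingDepth 3

open scoped Quaternion Manifold ContDiff

noncomputable section

/-- The octonions, as pairs of quaternions. -/
@[ext] structure Octonion where
  /-- The first quaternion component. -/
  left : ℍ[ℝ]
  /-- The second quaternion component. -/
  right : ℍ[ℝ]

namespace Octonion

instance : Zero Octonion := ⟨⟨0, 0⟩⟩
instance : Add Octonion := ⟨fun x y => ⟨x.left + y.left, x.right + y.right⟩⟩
instance : Neg Octonion := ⟨fun x => ⟨-x.left, -x.right⟩⟩
instance : Sub Octonion := ⟨fun x y => ⟨x.left - y.left, x.right - y.right⟩⟩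
instance : SMul ℝ Octonion := ⟨fun r x => ⟨r • x.left, r • x.right⟩⟩

@[simp] theorem left_add (x y : Octonion) : (x + y).left = x.left + y.left := rfl
@[simp] theorem right_add (x y : Octonion) : (x + y).right = x.right + y.right := rfl
@[simp] theorem left_neg (x : Octonion) : (-x).left = -x.left := rfl
@[simp] theorem right_neg (x : Octonion) : (-x).right = -x.right := rfl
@[simp] theorem left_sub (x y : Octonion) : (x - y).left = x.left - y.left := rfl
@[simp] theorem right_sub (x y : Octonion) : (x - y).right = x.right - y.right := rfl
@[simp] theorem left_smul (r : ℝ) (x : Octonion) : (r • x).left = r • x.left := rfl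
@[simp] theorem right_smul (r : ℝ) (x : Octonion) : (r • x).right = r • x.right := rfl
@[simp] theorem left_zero : (0 : Octonion).left = 0 := rfl
@[simp] theorem right_zero : (0 : Octonion).right = 0 := rfl

instance : AddCommGroup Octonion where
  add_assoc _ _ _ := Octonion.ext (add_assoc _ _ _) (add_assoc _ _ _)
  zero_add _ := Octonion.ext (zero_add _) (zero_add _)
  add_zero _ := Octonion.ext (add_zero _) (add_zero _)
  neg_add_cancel _ := Octonion.ext (neg_add_cancel _) (neg_add_cancel _)
  add_comm _ _ := Octonion.ext (add_comm _ _) (add_comm _ _)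
  sub_eq_add_neg _ _ := Octonion.ext (sub_eq_add_neg _ _) (sub_eq_add_neg _ _)
  nsmul := nsmulRec
  zsmul := zsmulRec

instance : Module ℝ Octonion where
  one_smul _ := Octonion.ext (one_smul _ _) (one_smul _ _)
  mul_smul _ _ _ := Octonion.ext (mul_smul _ _ _) (mul_smul _ _ _)
  smul_zero _ := Octonion.ext (smul_zero _) (smul_zero _)
  smul_add _ _ _ := Octonion.ext (smul_add _ _ _) (smul_add _ _ _)
  add_smul _ _ _ := Octonion.ext (add_smul _ _ _) (add_smul _ _ _)
  zero_smul _ := Octonion.ext (zero_smul _ _) (zero_smul _ _)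

/-- The octonions as a real vector space. -/
def equivProd : Octonion ≃ₗ[ℝ] ℍ[ℝ] × ℍ[ℝ] where
  toFun x := (x.left, x.right)
  invFun q := ⟨q.1, q.2⟩
  map_add' _ _ := rfl
  map_smul' _ _ := rfl
  left_inv _ := rfl
  right_inv _ := rfl

instance : FiniteDimensional ℝ Octonion := equivProd.symm.finiteDimensional

/-- The Cayley–Dickson product `(q₁,q₂)(p₁,p₂) = (q₁p₁ - p̄₂q₂, p₂q₁ + q₂p̄₁)`. -/
instance : Mul Octonion :=
  ⟨fun x y => ⟨x.left * y.left - star y.right * x.right,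
    y.right * x.left + x.right * star y.left⟩⟩

instance : One Octonion := ⟨⟨1, 0⟩⟩

/-- Octonionic conjugation. -/
instance : Star Octonion := ⟨fun x => ⟨star x.left, -x.right⟩⟩

/-- The real part. -/
def re (x : Octonion) : ℝ := x.left.re

@[simp] theorem left_one : (1 : Octonion).left = 1 := rfl
@[simp] theorem right_one : (1 : Octonion).right = 0 := rfl
@[simp] theorem left_mul (x y : Octonion) :
    (x * y).left = x.left * y.left - star y.right * x.right := rfl
@[simp] theorem right_mul (x y : Octonion) :
    (x * y).right = y.right * x.left + x.right * star y.left := rfl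
@[simp] theorem left_star (x : Octonion) : (star x).left = star x.left := rfl
@[simp] theorem right_star (x : Octonion) : (star x).right = -x.right := rfl

/-- The inner product `⟨x, y⟩ = Re (x ȳ)`. -/
instance : Inner ℝ Octonion := ⟨fun x y => re (x * star y)⟩

theorem inner_eq_re (x y : Octonion) : inner ℝ x y = re (x * star y) := rfl

theorem inner_coord (x y : Octonion) : inner ℝ x y =
    x.left.re * y.left.re + x.left.imI * y.left.imI + x.left.imJ * y.left.imJ
      + x.left.imK * y.left.imK
      + (x.right.re * y.right.re + x.right.imI * y.right.imI + x.right.imJ * y.right.imJ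
      + x.right.imK * y.right.imK) := by
  simp [inner_eq_re, re]
  ring

theorem inner_self_nonneg' (x : Octonion) : 0 ≤ inner ℝ x x := by
  rw [inner_coord]
  simp only [← sq]
  positivity

theorem eq_zero_of_inner_self (x : Octonion) (h : inner ℝ x x = 0) : x = 0 := by
  rw [inner_coord] at h
  ext <;> simp <;> nlinarith

instance : NormedAddCommGroup Octonion :=
  @InnerProductSpace.Core.toNormedAddCommGroup ℝ Octonion _ _ _
    { toInner := inferInstance
      conj_inner_symm := fun x y => by
        simp only [inner_coord, conj_trivial]
        ring
      re_inner_nonneg := inner_self_nonneg'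
      definite := eq_zero_of_inner_self
      add_left := fun x y z => by
        simp only [inner_coord, left_add, right_add, Quaternion.re_add, Quaternion.imI_add,
          Quaternion.imJ_add, Quaternion.imK_add]
        ring
      smul_left := fun x y r => by
        simp only [inner_coord, left_smul, right_smul, Quaternion.re_smul, Quaternion.imI_smul,
          Quaternion.imJ_smul, Quaternion.imK_smul, smul_eq_mul, conj_trivial]
        ring }

instance : InnerProductSpace ℝ Octonion := InnerProductSpace.ofCore _

/-- The inverse `x⁻¹ = x̄ / |x|²` (with `0⁻¹ = 0`). -/
instance : Inv Octonion := ⟨fun x => (‖x‖ ^ 2)⁻¹ • star x⟩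

theorem inv_def (x : Octonion) : x⁻¹ = (‖x‖ ^ 2)⁻¹ • star x := rfl

theorem norm_sq_coord (x : Octonion) : ‖x‖ ^ 2 =
    x.left.re ^ 2 + x.left.imI ^ 2 + x.left.imJ ^ 2 + x.left.imK ^ 2 +
    (x.right.re ^ 2 + x.right.imI ^ 2 + x.right.imJ ^ 2 + x.right.imK ^ 2) := by
  rw [← real_inner_self_eq_norm_sq, inner_coord]
  ring

theorem mul_mul_star (v x : Octonion) : v * x * star x = ‖x‖ ^ 2 • v := by
  ext <;> simp [norm_sq_coord] <;> ring

theorem mul_star_mul (v x : Octonion) : v * star x * x = ‖x‖ ^ 2 • v := by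
  ext <;> simp [norm_sq_coord] <;> ring

theorem norm_mul (x y : Octonion) : ‖x * y‖ = ‖x‖ * ‖y‖ := by
  rw [← sq_eq_sq₀ (by positivity) (by positivity), mul_pow]
  simp [norm_sq_coord]
  ring

theorem mul_smul (r : ℝ) (x y : Octonion) : x * (r • y) = r • (x * y) := by
  ext <;> simp <;> ring

theorem smul_mul (r : ℝ) (x y : Octonion) : (r • x) * y = r • (x * y) := by
  ext <;> simp <;> ring

theorem mul_add (x y z : Octonion) : x * (y + z) = x * y + x * z := by
  ext <;> simp <;> ring

theorem add_mul (x y z : Octonion) : (x + y) * z = x * z + y * z := by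
  ext <;> simp <;> ring

theorem star_add (x y : Octonion) : star (x + y) = star x + star y := by
  ext <;> simp <;> ring
theorem star_smul (r : ℝ) (x : Octonion) : star (r • x) = r • star x := by
  ext <;> simp 
theorem re_add (x y : Octonion) : re (x + y) = re x + re y := by
  simp [re]
theorem re_smul (r : ℝ) (x : Octonion) : re (r • x) = r * re x := by
  simp [re]

theorem one_mul (x : Octonion) : 1 * x = x := by ext <;> simp
theorem mul_one (x : Octonion) : x * 1 = x := by ext <;> simp
theorem zero_mul (x : Octonion) : 0 * x = 0 := by ext <;> simp
theorem mul_zero (x : Octonion) : x * 0 = 0 := by ext <;> simp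

theorem norm_one : ‖(1 : Octonion)‖ = 1 := by
  rw [← sq_eq_sq₀ (by positivity) (by positivity)]
  simp [norm_sq_coord]

theorem norm_star (x : Octonion) : ‖star x‖ = ‖x‖ := by
  rw [← sq_eq_sq₀ (by positivity) (by positivity)]
  simp [norm_sq_coord]

theorem norm_inv (x : Octonion) : ‖x⁻¹‖ = ‖x‖⁻¹ := by
  by_cases hx : x = 0
  · subst hx
    simp [inv_def]
  · have hx' : ‖x‖ ≠ 0 := norm_ne_zero_iff.2 hx
    rw [inv_def, norm_smul, norm_star, Real.norm_of_nonneg (by positivity)]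
    field_simp

theorem inv_ne_zero {x : Octonion} (hx : x ≠ 0) : x⁻¹ ≠ 0 := by
  rw [← norm_ne_zero_iff, norm_inv]
  exact _root_.inv_ne_zero (norm_ne_zero_iff.2 hx)

theorem mul_mul_inv {x : Octonion} (hx : x ≠ 0) (v : Octonion) : v * x * x⁻¹ = v := by
  have hx' : ‖x‖ ^ 2 ≠ 0 := pow_ne_zero 2 (norm_ne_zero_iff.2 hx)
  rw [inv_def, mul_smul, mul_mul_star, smul_smul, inv_mul_cancel₀ hx', one_smul]

theorem mul_inv_mul {x : Octonion} (hx : x ≠ 0) (v : Octonion) : v * x⁻¹ * x = v := by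
  have hx' : ‖x‖ ^ 2 ≠ 0 := pow_ne_zero 2 (norm_ne_zero_iff.2 hx)
  rw [inv_def, mul_smul, smul_mul, mul_star_mul, smul_smul, inv_mul_cancel₀ hx', one_smul]

theorem mul_inv_self {x : Octonion} (hx : x ≠ 0) : x * x⁻¹ = 1 := by
  simpa only [one_mul] using mul_mul_inv hx 1

theorem inv_mul_self {x : Octonion} (hx : x ≠ 0) : x⁻¹ * x = 1 := by
  simpa only [one_mul] using mul_inv_mul hx 1

theorem one_ne_zero : (1 : Octonion) ≠ 0 := by
  rw [← norm_ne_zero_iff, norm_one]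
  exact _root_.one_ne_zero

theorem inv_one : (1 : Octonion)⁻¹ = 1 := by
  simpa only [one_mul] using mul_inv_self one_ne_zero

theorem mul_ne_zero {x y : Octonion} (hx : x ≠ 0) (hy : y ≠ 0) : x * y ≠ 0 := by
  rw [← norm_ne_zero_iff, norm_mul]
  exact _root_.mul_ne_zero (norm_ne_zero_iff.2 hx) (norm_ne_zero_iff.2 hy)

theorem eq_inv_of_mul_eq_one {x y : Octonion} (h : x * y = 1) : x = y⁻¹ := by
  have hy : y ≠ 0 := by
    rintro rfl
    rw [mul_zero] at h
    exact one_ne_zero h.symm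
  rw [← mul_mul_inv hy x, h, one_mul]

theorem inv_inv {x : Octonion} (hx : x ≠ 0) : x⁻¹⁻¹ = x :=
  (eq_inv_of_mul_eq_one (mul_inv_self hx)).symm

/-- Multiplication as a bilinear map. -/
def mulL : Octonion →L[ℝ] Octonion →L[ℝ] Octonion :=
  (LinearMap.mk₂ ℝ (fun x y : Octonion => x * y) add_mul smul_mul mul_add
    mul_smul).toContinuousBilinearMap

/-- Conjugation as a linear map. -/
def starL : Octonion →L[ℝ] Octonion :=
  LinearMap.toContinuousLinearMap
    { toFun := fun x : Octonion => star x, map_add' := star_add, map_smul' := star_smul }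

theorem contDiff_mul {n : WithTop ℕ∞} : ContDiff ℝ n (fun x : Octonion × Octonion => x.1 * x.2) :=
  mulL.isBoundedBilinearMap.contDiff

theorem contDiffAt_inv {n : WithTop ℕ∞} {x : Octonion} (hx : x ≠ 0) :
    ContDiffAt ℝ n (fun x : Octonion => x⁻¹) x := by
  have h : ContDiffAt ℝ n (fun x : Octonion => (‖x‖ ^ 2)⁻¹ • starL x) x :=
    ((contDiff_norm_sq ℝ).contDiffAt.inv (pow_ne_zero 2 (norm_ne_zero_iff.2 hx))).smul
      starL.contDiff.contDiffAt
  exact h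

end Octonion

/-! ### Semi-Riemannian metrics, curvature, and the special Osserman conditions -/

namespace SemiRiemannian

section Coordinates

variable {E : Type*} [NormedAddCommGroup E] [NormedSpace ℝ E]

/-- Christoffel symbols of the first kind of a metric `G` given on (an open subset of) a vector
space: `(v, w, z) ↦ ½ (∂_v G(w,z) + ∂_w G(v,z) - ∂_z G(v,w))` at the point `p`. -/
def christoffelLower (G : E → E →L[ℝ] E →L[ℝ] ℝ) (p : E) : E →L[ℝ] E →L[ℝ] E →L[ℝ] ℝ :=
  let D : E →L[ℝ] E →L[ℝ] E →L[ℝ] ℝ := fderiv ℝ G p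
  let F : (E →L[ℝ] E →L[ℝ] ℝ) →L[ℝ] E →L[ℝ] E →L[ℝ] ℝ :=
    (ContinuousLinearMap.flipₗᵢ ℝ E E ℝ).toContinuousLinearEquiv
  let D' : E →L[ℝ] E →L[ℝ] E →L[ℝ] ℝ := F ∘L D.flip
  (1 / 2 : ℝ) • (D + D.flip - D')

theorem christoffelLower_apply (G : E → E →L[ℝ] E →L[ℝ] ℝ) (p v w z : E) :
    christoffelLower G p v w z =
      (1 / 2) * (fderiv ℝ G p v w z + fderiv ℝ G p w v z - fderiv ℝ G p z v w) := rfl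

/-- Christoffel symbols of the second kind, `Γ_p(v, w)`: the index is raised with the inverse of
`G p`, viewed as a map from vectors to covectors. -/
def christoffel (G : E → E →L[ℝ] E →L[ℝ] ℝ) (p : E) : E →L[ℝ] E →L[ℝ] E :=
  (ContinuousLinearMap.compL ℝ E (E →L[ℝ] ℝ) E (G p).inverse) ∘L christoffelLower G p

theorem christoffel_apply (G : E → E →L[ℝ] E →L[ℝ] ℝ) (p v w : E) :
    christoffel G p v w = (G p).inverse (christoffelLower G p v w) := rfl

/-- The Riemann curvature `R(x, y) z` of the Levi-Civita connection of `G` at `p`, with the sign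
convention `R(x, y) = ∇_[x,y] - [∇_x, ∇_y]`, for which `G(R(x, y) x, y)` is positive on the round
sphere. -/
def curvature (G : E → E →L[ℝ] E →L[ℝ] ℝ) (p x y z : E) : E :=
  fderiv ℝ (christoffel G) p y x z - fderiv ℝ (christoffel G) p x y z
    + christoffel G p y (christoffel G p x z) - christoffel G p x (christoffel G p y z)

/-- The Jacobi operator `x ↦ R(v, x) v` of `G` at `p`. -/
def coordJacobi (G : E → E →L[ℝ] E →L[ℝ] ℝ) (p v : E) : Module.End ℝ E where
  toFun x := curvature G p v x v
  map_add' x y := by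
    simp only [curvature, map_add, add_apply]
    abel
  map_smul' r x := by
    simp only [curvature, map_smul, smul_apply, RingHom.id_apply, smul_sub,
      smul_add]

end Coordinates

section Manifold

variable {E : Type*} [NormedAddCommGroup E] [NormedSpace ℝ E]
variable {M : Type*} [TopologicalSpace M] [ChartedSpace E M]

/-- A field of bilinear forms on the tangent spaces of `M`. -/
abbrev BilinField (E : Type*) [NormedAddCommGroup E] [NormedSpace ℝ E]
    (M : Type*) [TopologicalSpace M] [ChartedSpace E M] : Type _ :=
  (p : M) → TangentSpace 𝓘(ℝ, E) p →L[ℝ] TangentSpace 𝓘(ℝ, E) p →L[ℝ] ℝ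

variable [IsManifold 𝓘(ℝ, E) ∞ M]

/-- The expression of `g` in the preferred chart around `x`: at a point `y` of the target of the
chart, corresponding to `q ∈ M`, coordinate vectors are first turned into tangent vectors at `q`. -/
def inChart (g : BilinField E M) (x : M) (y : E) : E →L[ℝ] E →L[ℝ] ℝ :=
  let q : M := (chartAt E x).symm y
  ContinuousLinearMap.bilinearComp (E := E) (F := E) (g q)
    (tangentCoordChange 𝓘(ℝ, E) x q q) (tangentCoordChange 𝓘(ℝ, E) x q q)

/-- `g` is a semi-Riemannian metric: symmetric, non-degenerate, and smooth in charts. -/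
structure IsMetric (g : BilinField E M) : Prop where
  symm : ∀ (p : M) (v w : TangentSpace 𝓘(ℝ, E) p), g p v w = g p w v
  nondegenerate : ∀ (p : M) (v : TangentSpace 𝓘(ℝ, E) p), (∀ w, g p v w = 0) → v = 0
  smooth : ∀ x : M, ContDiffOn ℝ ∞ (inChart g x) (chartAt E x).target

/-- `g` has signature `(r, s)` at every point. -/
def HasSignature (g : BilinField E M) (r s : ℕ) : Prop :=
  ∀ p : M, sigPos (LinearMap.BilinMap.toQuadraticMap (g p).toBilinForm) = r ∧
    sigNeg (LinearMap.BilinMap.toQuadraticMap (g p).toBilinForm) = s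

/-- The Jacobi operator `𝒥_v : x ↦ R(v, x) v` on `T_p M`. The curvature is computed in the preferred
chart around `p`; the tangent space at `p` is, by its definition, identified with the model space
by means of this chart. -/
def jacobi (g : BilinField E M) (p : M) (v : TangentSpace 𝓘(ℝ, E) p) :
    Module.End ℝ (TangentSpace 𝓘(ℝ, E) p) :=
  coordJacobi (E := E) (inChart g p) (chartAt E p p) v

/-- Unit tangent vectors: `g(v, v) = ±1`. -/
def IsUnitVector (g : BilinField E M) (p : M) (v : TangentSpace 𝓘(ℝ, E) p) : Prop :=
  g p v v = 1 ∨ g p v v = -1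

/-- The orthogonal complement `v^⊥`. -/
def perp (g : BilinField E M) (p : M) (v : TangentSpace 𝓘(ℝ, E) p) :
    Submodule ℝ (TangentSpace 𝓘(ℝ, E) p) :=
  LinearMap.ker (g p v).toLinearMap

/-- The eigenspace `ker (𝒥_v - ε_v t)`, where `ε_v = g(v, v)`. -/
def jacobiEigenspace (g : BilinField E M) (p : M) (v : TangentSpace 𝓘(ℝ, E) p) (t : ℝ) :
    Submodule ℝ (TangentSpace 𝓘(ℝ, E) p) :=
  LinearMap.ker (jacobi g p v - (g p v v * t) • LinearMap.id)

/-- The space `E_t(v) = span {v} + ker (𝒥_v - ε_v t)`. -/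
def extendedEigenspace (g : BilinField E M) (p : M) (v : TangentSpace 𝓘(ℝ, E) p) (t : ℝ) :
    Submodule ℝ (TangentSpace 𝓘(ℝ, E) p) :=
  Submodule.span ℝ {v} ⊔ jacobiEigenspace g p v t

/-- `(M, g)` is a special Osserman manifold, with the constants `l` and `m` (called `λ` and `μ` in the
literature), which depend neither on the point nor on the unit vector. -/
structure IsSpecialOssermanWith (g : BilinField E M) (l m : ℝ) : Prop where
  isMetric : IsMetric g
  left_ne_zero : l ≠ 0
  right_ne_zero : m ≠ 0
  ne : l ≠ m
  /-- For a unit vector `v` the operator `𝒥_v` maps `v^⊥` to itself, is diagonalizable there, and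
  its nonzero eigenvalues on `v^⊥` are exactly `ε_v l` and `ε_v m`. -/
  condition_I : ∀ (p : M) (v : TangentSpace 𝓘(ℝ, E) p), IsUnitVector g p v →
    ∃ h : ∀ x ∈ perp g p v, jacobi g p v x ∈ perp g p v,
      (⨆ t : ℝ, Module.End.eigenspace ((jacobi g p v).restrict h) t) = ⊤ ∧
      {t : ℝ | t ≠ 0 ∧ Module.End.HasEigenvalue ((jacobi g p v).restrict h) t} =
        {g p v v * l, g p v v * m}
  condition_II : ∀ (p : M) (v w : TangentSpace 𝓘(ℝ, E) p), IsUnitVector g p v →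
    IsUnitVector g p w → w ∈ extendedEigenspace g p v l →
      extendedEigenspace g p v l = extendedEigenspace g p w l
  condition_III : ∀ (p : M) (v w : TangentSpace 𝓘(ℝ, E) p), IsUnitVector g p v →
    w ∈ jacobiEigenspace g p v m → v ∈ jacobiEigenspace g p w m

end Manifold

end SemiRiemannian

/-! ### The indefinite octonionic projective plane -/

namespace OP11

/-- The affine piece `{(1, u, v) : 1 + |u|² - |v|² > 0}` of `𝕆³`. -/
def U₁ : Set (Octonion × Octonion × Octonion) :=
  {t | t.1 = 1 ∧ 0 < 1 + ‖t.2.1‖ ^ 2 - ‖t.2.2‖ ^ 2}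

/-- The affine piece `{(u, 1, v) : |u|² + 1 - |v|² > 0}` of `𝕆³`. -/
def U₂ : Set (Octonion × Octonion × Octonion) :=
  {t | t.2.1 = 1 ∧ 0 < ‖t.1‖ ^ 2 + 1 - ‖t.2.2‖ ^ 2}

/-- The relation `[a,b,c] ∼ [d,e,f]`: `a = dλ`, `b = eλ`, `c = fλ` for some `λ ≠ 0`. -/
def Rel (s t : Octonion × Octonion × Octonion) : Prop :=
  ∃ l : Octonion, l ≠ 0 ∧ s.1 = t.1 * l ∧ s.2.1 = t.2.1 * l ∧ s.2.2 = t.2.2 * l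

/-- Reduced homogeneous coordinates: points of `U₁ ∪ U₂`. -/
abbrev Coords : Type := ↥(U₁ ∪ U₂)

/-- First affine coordinates `(b a⁻¹, c a⁻¹)`. -/
def aff (t : Octonion × Octonion × Octonion) : Octonion × Octonion :=
  (t.2.1 * t.1⁻¹, t.2.2 * t.1⁻¹)

/-- Interchange of the first two homogeneous coordinates. -/
def swapTriple (t : Octonion × Octonion × Octonion) : Octonion × Octonion × Octonion :=
  (t.2.1, t.1, t.2.2)

theorem aff_of_mem_U₁ {t : Octonion × Octonion × Octonion} (ht : t ∈ U₁) :
    aff t = (t.2.1, t.2.2) := by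
  simp only [aff, ht.1, Octonion.inv_one, Octonion.mul_one]

theorem aff_of_mem_U₂ {t : Octonion × Octonion × Octonion} (ht : t ∈ U₂) :
    aff t = (t.1⁻¹, t.2.2 * t.1⁻¹) := by
  simp only [aff, ht.1, Octonion.one_mul]

theorem rel_refl (t : Octonion × Octonion × Octonion) : Rel t t :=
  ⟨1, Octonion.one_ne_zero, (Octonion.mul_one _).symm, (Octonion.mul_one _).symm,
    (Octonion.mul_one _).symm⟩

theorem rel_symm {s t : Octonion × Octonion × Octonion} (h : Rel s t) : Rel t s := by
  obtain ⟨l, hl, h₁, h₂, h₃⟩ := h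
  exact ⟨l⁻¹, Octonion.inv_ne_zero hl, by rw [h₁, Octonion.mul_mul_inv hl],
    by rw [h₂, Octonion.mul_mul_inv hl], by rw [h₃, Octonion.mul_mul_inv hl]⟩

theorem rel_fst {s t : Octonion × Octonion × Octonion} (h : Rel s t) (ht : t.1 ≠ 0) :
    s.1 ≠ 0 := by
  obtain ⟨l, hl, h₁, -, -⟩ := h
  rw [h₁]
  exact Octonion.mul_ne_zero ht hl

theorem eq_of_rel_one {s t : Octonion × Octonion × Octonion} {l : Octonion} (hl : l = 1)
    (h₁ : s.1 = t.1 * l) (h₂ : s.2.1 = t.2.1 * l) (h₃ : s.2.2 = t.2.2 * l) : s = t := by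
  subst hl
  simp only [Octonion.mul_one] at h₁ h₂ h₃
  exact Prod.ext h₁ (Prod.ext h₂ h₃)

theorem eq_of_rel_U₂ {s t : Octonion × Octonion × Octonion} (hs : s ∈ U₂) (ht : t ∈ U₂)
    (h : Rel s t) : s = t := by
  obtain ⟨l, -, h₁, h₂, h₃⟩ := h
  have h4 := h₂
  rw [hs.1, ht.1, Octonion.one_mul] at h4
  exact eq_of_rel_one h4.symm h₁ h₂ h₃

theorem eq_of_rel_U₁ {s t : Octonion × Octonion × Octonion} (hs : s ∈ U₁) (ht : t ∈ U₁)
    (h : Rel s t) : s = t := by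
  obtain ⟨l, -, h₁, h₂, h₃⟩ := h
  have h4 := h₁
  rw [hs.1, ht.1, Octonion.one_mul] at h4
  exact eq_of_rel_one h4.symm h₁ h₂ h₃

theorem aff_eq_of_rel_U₁_U₂ {s t : Octonion × Octonion × Octonion} (hs : s ∈ U₁) (ht : t ∈ U₂)
    (h : Rel s t) : aff s = aff t := by
  obtain ⟨l, hl, h₁, h₂, h₃⟩ := h
  rw [hs.1] at h₁
  rw [ht.1, Octonion.one_mul] at h₂
  have h4 := Octonion.eq_inv_of_mul_eq_one h₁.symm
  rw [aff_of_mem_U₁ hs, aff_of_mem_U₂ ht, h4, Octonion.inv_inv hl, h₂, h₃]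

theorem aff_eq_of_rel {s t : Octonion × Octonion × Octonion} (hs : s ∈ U₁ ∪ U₂)
    (ht : t ∈ U₁ ∪ U₂) (h : Rel s t) : aff s = aff t := by
  rcases hs with hs | hs <;> rcases ht with ht | ht
  · rw [eq_of_rel_U₁ hs ht h]
  · exact aff_eq_of_rel_U₁_U₂ hs ht h
  · exact (aff_eq_of_rel_U₁_U₂ ht hs (rel_symm h)).symm
  · rw [eq_of_rel_U₂ hs ht h]

theorem rel_of_aff_eq_U₂_U₁ {s t : Octonion × Octonion × Octonion} (hs : s ∈ U₂) (ht : t ∈ U₁)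
    (hs₀ : s.1 ≠ 0) (h : aff s = aff t) : Rel s t := by
  rw [aff_of_mem_U₂ hs, aff_of_mem_U₁ ht, Prod.mk.injEq] at h
  refine ⟨s.1, hs₀, ?_, ?_, ?_⟩
  · rw [ht.1, Octonion.one_mul]
  · rw [← h.1, Octonion.inv_mul_self hs₀, hs.1]
  · rw [← h.2, Octonion.mul_inv_mul hs₀]

theorem rel_of_aff_eq {s t : Octonion × Octonion × Octonion} (hs : s ∈ U₁ ∪ U₂)
    (ht : t ∈ U₁ ∪ U₂) (hs₀ : s.1 ≠ 0) (ht₀ : t.1 ≠ 0) (h : aff s = aff t) : Rel s t := by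
  rcases hs with hs | hs <;> rcases ht with ht | ht
  · rw [aff_of_mem_U₁ hs, aff_of_mem_U₁ ht] at h
    have : s = t := Prod.ext (hs.1.trans ht.1.symm) h
    rw [this]
    exact rel_refl t
  · exact rel_symm (rel_of_aff_eq_U₂_U₁ ht hs ht₀ h.symm)
  · exact rel_of_aff_eq_U₂_U₁ hs ht hs₀ h
  · rw [aff_of_mem_U₂ hs, aff_of_mem_U₂ ht, Prod.mk.injEq] at h
    have h₁ : s.1 = t.1 := by rw [← Octonion.inv_inv hs₀, h.1, Octonion.inv_inv ht₀]
    have h₃ : s.2.2 = t.2.2 := by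
      rw [← Octonion.mul_inv_mul hs₀ s.2.2, h.2, h₁, Octonion.mul_inv_mul ht₀]
    have : s = t := Prod.ext h₁ (Prod.ext (hs.1.trans ht.1.symm) h₃)
    rw [this]
    exact rel_refl t

theorem mem_U₂_of_fst_eq_zero {t : Octonion × Octonion × Octonion} (ht : t ∈ U₁ ∪ U₂)
    (h : t.1 = 0) : t ∈ U₂ := by
  rcases ht with ht | ht
  · exact absurd (ht.1.symm.trans h) Octonion.one_ne_zero
  · exact ht

/-- The relation `∼` is an equivalence relation on `U₁ ∪ U₂`. -/
instance setoid : Setoid Coords where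
  r s t := Rel s.1 t.1
  iseqv :=
    { refl := fun t => rel_refl t.1
      symm := fun h => rel_symm h
      trans := by
        intro s t r h h'
        by_cases hs : s.1.1 = 0
        · have ht : t.1.1 = 0 := by
            by_contra ht
            exact rel_fst h ht hs
          rw [eq_of_rel_U₂ (mem_U₂_of_fst_eq_zero s.2 hs) (mem_U₂_of_fst_eq_zero t.2 ht) h]
          exact h'
        · have ht : t.1.1 ≠ 0 := rel_fst (rel_symm h) hs
          have hr : r.1.1 ≠ 0 := rel_fst (rel_symm h') ht
          exact rel_of_aff_eq s.2 r.2 hs hr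
            ((aff_eq_of_rel s.2 t.2 h).trans (aff_eq_of_rel t.2 r.2 h')) }

end OP11

/-- The indefinite octonionic projective plane `𝕆P^(1,1) = (U₁ ∪ U₂)/∼`. -/
def OP11 : Type := Quotient OP11.setoid

namespace OP11

/-- The quotient topology of the subspace topology of `U₁ ∪ U₂ ⊆ 𝕆³`. -/
instance : TopologicalSpace OP11 := inferInstanceAs (TopologicalSpace (Quotient OP11.setoid))

/-- The class `[a, b, c]` of homogeneous coordinates. -/
def toPlane (t : Coords) : OP11 := Quotient.mk OP11.setoid t

theorem isQuotientMap_toPlane : Topology.IsQuotientMap toPlane := isQuotientMap_quotient_mk'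

theorem toPlane_surjective : Function.Surjective toPlane := Quotient.exists_rep

theorem toPlane_eq_iff {s t : Coords} : toPlane s = toPlane t ↔ Rel s.1 t.1 := Quotient.eq

/-- The common image `{(u, v) : 1 + |u|² - |v|² > 0}` of both charts. -/
def domain : Set (Octonion × Octonion) := {y | 0 < 1 + ‖y.1‖ ^ 2 - ‖y.2‖ ^ 2}

theorem isOpen_domain : IsOpen domain :=
  isOpen_lt continuous_const (by fun_prop)

/-- The point `(1, u, v)` of `U₁`. -/
def point₁ (y : domain) : Coords := ⟨(1, y.1.1, y.1.2), Or.inl ⟨rfl, y.2⟩⟩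

theorem aff_mem_domain {t : Octonion × Octonion × Octonion} (ht : t ∈ U₁ ∪ U₂) (h : t.1 ≠ 0) :
    aff t ∈ domain := by
  rcases ht with ht | ht
  · rw [aff_of_mem_U₁ ht]
    exact ht.2
  · rw [aff_of_mem_U₂ ht]
    have hn : 0 < ‖t.1‖ := norm_pos_iff.2 h
    have h2 := ht.2
    have h3 : 1 + ‖t.1⁻¹‖ ^ 2 - ‖t.2.2 * t.1⁻¹‖ ^ 2 =
        (‖t.1‖ ^ 2 + 1 - ‖t.2.2‖ ^ 2) * (‖t.1‖ ^ 2)⁻¹ := by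
      rw [Octonion.norm_mul, Octonion.norm_inv]
      field_simp
    change 0 < 1 + ‖t.1⁻¹‖ ^ 2 - ‖t.2.2 * t.1⁻¹‖ ^ 2
    rw [h3]
    positivity

/-- The open subset `U₁/∼`. -/
def source₁ : Set OP11 := toPlane '' {t | t.1 ∈ U₁}

theorem toPlane_mem_source₁ {t : Coords} : toPlane t ∈ source₁ ↔ t.1.1 ≠ 0 := by
  constructor
  · rintro ⟨s, hs, hst⟩
    refine rel_fst (rel_symm (toPlane_eq_iff.1 hst)) ?_
    rw [hs.1]
    exact Octonion.one_ne_zero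
  · intro h
    have hm := aff_mem_domain t.2 h
    refine ⟨point₁ ⟨aff t.1, hm⟩, ⟨rfl, hm⟩, toPlane_eq_iff.2 ?_⟩
    refine rel_of_aff_eq (point₁ ⟨aff t.1, hm⟩).2 t.2 Octonion.one_ne_zero h ?_
    exact aff_of_mem_U₁ (t := (1, (aff t.1).1, (aff t.1).2)) ⟨rfl, hm⟩

theorem isOpen_source₁ : IsOpen source₁ := by
  rw [← isQuotientMap_toPlane.isOpen_preimage]
  have h : toPlane ⁻¹' source₁ = {t : Coords | t.1.1 ≠ 0} := by
    ext t
    exact toPlane_mem_source₁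
  rw [h]
  exact isOpen_ne_fun (continuous_fst.comp continuous_subtype_val) continuous_const

theorem contDiffAt_aff {t : Octonion × Octonion × Octonion} (ht : t.1 ≠ 0) :
    ContDiffAt ℝ ∞ aff t := by
  have h1 : ContDiffAt ℝ ∞ (fun t : Octonion × Octonion × Octonion => t.1⁻¹) t :=
    (Octonion.contDiffAt_inv ht).comp t contDiffAt_fst
  have h2 : ContDiffAt ℝ ∞ (fun t : Octonion × Octonion × Octonion => t.2) t := contDiffAt_snd
  exact (Octonion.contDiff_mul.contDiffAt.comp t (h2.fst.prodMk h1)).prodMk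
    (Octonion.contDiff_mul.contDiffAt.comp t (h2.snd.prodMk h1))

/-- The point `[1, 0, 0]`. -/
def basePoint : OP11 :=
  toPlane ⟨(1, 0, 0), Or.inl ⟨rfl, by simp⟩⟩

/-- The coordinates of the first chart: `[1, u, v] ↦ (u, v)`. -/
def coord₁ : OP11 → Octonion × Octonion :=
  Quotient.lift (fun t : Coords => aff t.1) fun s t h => aff_eq_of_rel s.2 t.2 h

theorem coord₁_toPlane (t : Coords) : coord₁ (toPlane t) = aff t.1 := rfl

open Classical in
/-- The inverse `(u, v) ↦ [1, u, v]` of the first chart. -/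
def coordInv₁ (y : Octonion × Octonion) : OP11 :=
  if h : y ∈ domain then toPlane (point₁ ⟨y, h⟩) else basePoint

theorem coordInv₁_of_mem {y : Octonion × Octonion} (h : y ∈ domain) :
    coordInv₁ y = toPlane (point₁ ⟨y, h⟩) := dif_pos h

theorem aff_point₁ (y : domain) : aff (point₁ y).1 = y.1 :=
  aff_of_mem_U₁ (t := (1, y.1.1, y.1.2)) ⟨rfl, y.2⟩

theorem coord₁_mem {p : OP11} (hp : p ∈ source₁) : coord₁ p ∈ domain := by
  obtain ⟨t, rfl⟩ := toPlane_surjective p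
  rw [coord₁_toPlane]
  exact aff_mem_domain t.2 (toPlane_mem_source₁.1 hp)

theorem coordInv₁_mem {y : Octonion × Octonion} (hy : y ∈ domain) : coordInv₁ y ∈ source₁ := by
  rw [coordInv₁_of_mem hy, toPlane_mem_source₁]
  exact Octonion.one_ne_zero

theorem coordInv₁_coord₁ {p : OP11} (hp : p ∈ source₁) : coordInv₁ (coord₁ p) = p := by
  obtain ⟨t, rfl⟩ := toPlane_surjective p
  have h := toPlane_mem_source₁.1 hp
  have hm := aff_mem_domain t.2 h
  rw [coord₁_toPlane, coordInv₁_of_mem hm, toPlane_eq_iff]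
  exact rel_of_aff_eq (point₁ ⟨aff t.1, hm⟩).2 t.2 Octonion.one_ne_zero h (aff_point₁ _)

theorem coord₁_coordInv₁ {y : Octonion × Octonion} (hy : y ∈ domain) :
    coord₁ (coordInv₁ y) = y := by
  rw [coordInv₁_of_mem hy, coord₁_toPlane, aff_point₁]

theorem continuousOn_coord₁ : ContinuousOn coord₁ source₁ := by
  rw [isQuotientMap_toPlane.continuousOn_isOpen_iff isOpen_source₁]
  intro t ht
  have h : ContinuousAt (fun t : Coords => aff t.1) t :=
    ContinuousAt.comp (g := aff) (f := fun t : Coords => t.1)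
      (contDiffAt_aff (toPlane_mem_source₁.1 ht)).continuousAt continuousAt_subtype_val
  exact h.continuousWithinAt

theorem continuous_point₁ : Continuous point₁ := by
  refine Continuous.subtype_mk ?_ _
  exact continuous_const.prodMk continuous_subtype_val

theorem continuousOn_coordInv₁ : ContinuousOn coordInv₁ domain := by
  rw [continuousOn_iff_continuous_domRestrict]
  have h : domain.domRestrict coordInv₁ = fun y => toPlane (point₁ y) := by
    ext y
    rw [Set.domRestrict_apply, coordInv₁_of_mem y.2]
  rw [h]
  exact isQuotientMap_toPlane.continuous.comp continuous_point₁

/-- The first chart `[1, u, v] ↦ (u, v)`, defined on `U₁/∼`. -/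
def chart₁ : OpenPartialHomeomorph OP11 (Octonion × Octonion) where
  toFun := coord₁
  invFun := coordInv₁
  source := source₁
  target := domain
  map_source' _ hp := coord₁_mem hp
  map_target' _ hy := coordInv₁_mem hy
  left_inv' _ hp := coordInv₁_coord₁ hp
  right_inv' _ hy := coord₁_coordInv₁ hy
  open_source := isOpen_source₁
  open_target := isOpen_domain
  continuousOn_toFun := continuousOn_coord₁
  continuousOn_invFun := continuousOn_coordInv₁

theorem swapTriple_mem {t : Octonion × Octonion × Octonion} (ht : t ∈ U₁ ∪ U₂) :
    swapTriple t ∈ U₁ ∪ U₂ := by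
  rcases ht with ht | ht
  · refine Or.inr ⟨ht.1, ?_⟩
    have := ht.2
    simp only [swapTriple]
    linarith
  · refine Or.inl ⟨ht.1, ?_⟩
    have := ht.2
    simp only [swapTriple]
    linarith

/-- The map `[a, b, c] ↦ [b, a, c]`. -/
def swapFun : OP11 → OP11 :=
  Quotient.lift (fun t : Coords => toPlane ⟨swapTriple t.1, swapTriple_mem t.2⟩) fun _ _ h => by
    obtain ⟨l, hl, h₁, h₂, h₃⟩ := h
    exact toPlane_eq_iff.2 ⟨l, hl, h₂, h₁, h₃⟩

theorem swapFun_toPlane (t : Coords) :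
    swapFun (toPlane t) = toPlane ⟨swapTriple t.1, swapTriple_mem t.2⟩ := rfl

theorem swapFun_swapFun (p : OP11) : swapFun (swapFun p) = p := by
  obtain ⟨t, rfl⟩ := toPlane_surjective p
  rfl

theorem continuous_swapFun : Continuous swapFun := by
  rw [isQuotientMap_toPlane.continuous_iff]
  refine isQuotientMap_toPlane.continuous.comp (Continuous.subtype_mk ?_ _)
  unfold swapTriple
  fun_prop

/-- The map `[a, b, c] ↦ [b, a, c]` as a homeomorphism. -/
def swap : OP11 ≃ₜ OP11 where
  toFun := swapFun
  invFun := swapFun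
  left_inv := swapFun_swapFun
  right_inv := swapFun_swapFun
  continuous_toFun := continuous_swapFun
  continuous_invFun := continuous_swapFun

/-- The second chart `[u, 1, v] ↦ (u, v)`, defined on `U₂/∼`. -/
def chart₂ : OpenPartialHomeomorph OP11 (Octonion × Octonion) :=
  swap.transOpenPartialHomeomorph chart₁

theorem chart₁_apply (u v : Octonion) (h : (1, u, v) ∈ U₁) :
    chart₁ (toPlane ⟨(1, u, v), Or.inl h⟩) = (u, v) := aff_of_mem_U₁ h

theorem chart₂_apply (u v : Octonion) (h : (u, 1, v) ∈ U₂) :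
    chart₂ (toPlane ⟨(u, 1, v), Or.inr h⟩) = (u, v) :=
  aff_of_mem_U₁ (t := (1, u, v)) ⟨rfl, by have := h.2; simp only at this ⊢; linarith⟩

theorem mem_chart₂_source {t : Coords} : toPlane t ∈ chart₂.source ↔ t.1.2.1 ≠ 0 :=
  toPlane_mem_source₁ (t := ⟨swapTriple t.1, swapTriple_mem t.2⟩)

theorem chart₁_source : chart₁.source = toPlane '' {t | t.1 ∈ U₁} := rfl

theorem chart₂_source : chart₂.source = toPlane '' {t | t.1 ∈ U₂} := by
  ext p
  constructor
  · rintro ⟨s, hs, hsp⟩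
    refine ⟨⟨swapTriple s.1, swapTriple_mem s.2⟩, ⟨hs.1, ?_⟩, ?_⟩
    · have := hs.2
      simp only [swapTriple]
      linarith
    · have h2 : swapFun (toPlane s) = swapFun (swapFun p) := congrArg swapFun hsp
      rw [swapFun_swapFun] at h2
      exact h2
  · rintro ⟨t, ht, rfl⟩
    rw [mem_chart₂_source, ht.1]
    exact Octonion.one_ne_zero

open Classical in
instance : ChartedSpace (Octonion × Octonion) OP11 where
  atlas := {chart₁, chart₂}
  chartAt p := if p ∈ chart₁.source then chart₁ else chart₂
  mem_chart_source p := by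
    by_cases h : p ∈ chart₁.source
    · rw [if_pos h]
      exact h
    · rw [if_neg h]
      obtain ⟨t, rfl⟩ := toPlane_surjective p
      have h0 : t.1.1 = 0 := by
        by_contra h0
        exact h (toPlane_mem_source₁.2 h0)
      rw [mem_chart₂_source, (mem_U₂_of_fst_eq_zero t.2 h0).1]
      exact Octonion.one_ne_zero
  chart_mem_atlas p := by
    by_cases h : p ∈ chart₁.source
    · rw [if_pos h]
      exact Or.inl rfl
    · rw [if_neg h]
      exact Or.inr rfl

theorem chartAt_basePoint : chartAt (Octonion × Octonion) basePoint = chart₁ :=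
  if_pos (toPlane_mem_source₁.2 Octonion.one_ne_zero)

/-- The transition map `(u, v) ↦ (u⁻¹, v u⁻¹)` between the two charts. -/
def transition (y : Octonion × Octonion) : Octonion × Octonion := (y.1⁻¹, y.2 * y.1⁻¹)

theorem contDiffAt_transition {y : Octonion × Octonion} (hy : y.1 ≠ 0) :
    ContDiffAt ℝ ∞ transition y := by
  have h1 : ContDiffAt ℝ ∞ (fun y : Octonion × Octonion => y.1⁻¹) y :=
    (Octonion.contDiffAt_inv hy).comp y contDiffAt_fst
  exact h1.prodMk (Octonion.contDiff_mul.contDiffAt.comp y (contDiffAt_snd.prodMk h1))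

theorem swapFun_coordInv₁ {y : Octonion × Octonion} (hy : y ∈ domain) :
    ∃ h : (y.1, 1, y.2) ∈ U₂, swapFun (coordInv₁ y) = toPlane ⟨(y.1, 1, y.2), Or.inr h⟩ := by
  have h : 0 < 1 + ‖y.1‖ ^ 2 - ‖y.2‖ ^ 2 := hy
  refine ⟨⟨rfl, ?_⟩, ?_⟩
  · simp only
    linarith
  · rw [coordInv₁_of_mem hy]
    rfl

theorem coord₁_swapFun_coordInv₁ {y : Octonion × Octonion} (hy : y ∈ domain) :
    coord₁ (swapFun (coordInv₁ y)) = transition y := by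
  obtain ⟨h, h'⟩ := swapFun_coordInv₁ hy
  rw [h', coord₁_toPlane]
  exact aff_of_mem_U₂ h

theorem fst_ne_zero_of_swapFun_mem {y : Octonion × Octonion} (hy : y ∈ domain)
    (h : swapFun (coordInv₁ y) ∈ source₁) : y.1 ≠ 0 := by
  obtain ⟨h', h''⟩ := swapFun_coordInv₁ hy
  rw [h'', toPlane_mem_source₁] at h
  exact h

theorem contDiffOn_transition {f : Octonion × Octonion → Octonion × Octonion}
    {s : Set (Octonion × Octonion)} (hs : ∀ y ∈ s, y.1 ≠ 0) (hf : ∀ y ∈ s, f y = transition y) :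
    ContDiffOn ℝ ∞ f s := by
  have h : ContDiffOn ℝ ∞ transition s := fun y hy =>
    (contDiffAt_transition (hs y hy)).contDiffWithinAt
  exact h.congr hf

instance : IsManifold 𝓘(ℝ, Octonion × Octonion) ∞ OP11 := by
  apply isManifold_of_contDiffOn
  have hid : ∀ e : OpenPartialHomeomorph OP11 (Octonion × Octonion),
      ContDiffOn ℝ ∞ (e.symm ≫ₕ e) (e.symm ≫ₕ e).source := fun e =>
    contDiffOn_id.congr fun y hy => e.right_inv hy.1
  intro e e' he he'
  change e ∈ ({chart₁, chart₂} : Set _) at he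
  change e' ∈ ({chart₁, chart₂} : Set _) at he'
  simp only [modelWithCornersSelf_coe, modelWithCornersSelf_coe_symm, Function.id_comp,
    Function.comp_id, Set.preimage_id, Set.range_id, Set.inter_univ]
  rcases he with rfl | rfl <;> rcases he' with rfl | rfl
  · exact hid _
  · exact contDiffOn_transition (fun y hy => fst_ne_zero_of_swapFun_mem hy.1 hy.2)
      (fun y hy => coord₁_swapFun_coordInv₁ hy.1)
  · exact contDiffOn_transition (fun y hy => fst_ne_zero_of_swapFun_mem hy.1 hy.2)
      (fun y hy => coord₁_swapFun_coordInv₁ hy.1)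
  · exact hid _

/-- The polarization of
`ds² = (|du|²(1 - |v|²) - |dv|²(1 + |u|²) + 2 Re[(u v̄)(dv dū)]) / (1 + |u|² - |v|²)²`
at the point `y = (u, v)`. -/
def coordMetricFun (y w z : Octonion × Octonion) : ℝ :=
  (inner ℝ w.1 z.1 * (1 - ‖y.2‖ ^ 2) - inner ℝ w.2 z.2 * (1 + ‖y.1‖ ^ 2)
    + (Octonion.re ((y.1 * star y.2) * (w.2 * star z.1))
      + Octonion.re ((y.1 * star y.2) * (z.2 * star w.1))))
    / (1 + ‖y.1‖ ^ 2 - ‖y.2‖ ^ 2) ^ 2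

/-- The expression of the metric in either chart, as a continuous bilinear form. -/
def coordMetric (y : Octonion × Octonion) :
    (Octonion × Octonion) →L[ℝ] (Octonion × Octonion) →L[ℝ] ℝ :=
  (LinearMap.mk₂ ℝ (coordMetricFun y)
    (fun w w' z => by
      simp only [coordMetricFun, Prod.fst_add, Prod.snd_add, inner_add_left, Octonion.add_mul,
        Octonion.star_add, Octonion.mul_add, Octonion.re_add]
      ring)
    (fun r w z => by
      simp only [coordMetricFun, Prod.smul_fst, Prod.smul_snd, real_inner_smul_left,
        Octonion.smul_mul, Octonion.star_smul, Octonion.mul_smul, Octonion.re_smul, smul_eq_mul]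
      ring)
    (fun w z z' => by
      simp only [coordMetricFun, Prod.fst_add, Prod.snd_add, inner_add_right, Octonion.add_mul,
        Octonion.star_add, Octonion.mul_add, Octonion.re_add]
      ring)
    (fun r w z => by
      simp only [coordMetricFun, Prod.smul_fst, Prod.smul_snd, real_inner_smul_right,
        Octonion.smul_mul, Octonion.star_smul, Octonion.mul_smul, Octonion.re_smul, smul_eq_mul]
      ring)).toContinuousBilinearMap

theorem coordMetric_apply (y w z : Octonion × Octonion) :
    coordMetric y w z = coordMetricFun y w z := rfl

/-- The metric of `𝕆P^(1,1)`, given at `p` by `coordMetric` in the preferred chart at `p`. -/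
def metric : SemiRiemannian.BilinField (Octonion × Octonion) OP11 :=
  fun p => coordMetric (chartAt (Octonion × Octonion) p p)

/-- The identification of the tangent space at `[1, 0, 0]` with pairs of octonions: the differential
of the first chart `[1, u, v] ↦ (u, v)`. -/
def tangentCoord : TangentSpace 𝓘(ℝ, Octonion × Octonion) basePoint →L[ℝ] Octonion × Octonion :=
  mfderiv 𝓘(ℝ, Octonion × Octonion) 𝓘(ℝ, Octonion × Octonion) chart₁ basePoint

end OP11

end

/-!
In affine coordinates the metric is half the pull-back of the quadratic form `X ↦ tr (XηXη)`,
`η = diag (1, 1, -1)`, on Hermitian octonionic matrices under the Veronese map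
`t ↦ t t* / (t*ηt)`, `t = (1, u, v)`. A map of the vectors `t` is therefore a local isometry if it
induces a linear isometry of the matrices `t t*`. This applies to the real rotations of the first
two coordinates, among them the change of charts, to the real boosts, and, by the middle Moufang
identity, to `(1, u, v) ↦ (1, au, āv)` with `|a| = 1`. Together these maps act transitively, so
the curvature is needed only at the origin. There the first derivatives of the metric vanish, and
the second ones give `𝒥_v x = 4 (g(v, v) x - g(v, x) v) + 3 D_v x`, where `-D_v / g(v, v)` is the
projection along the octonionic line through `v` onto its orthogonal complement. So the eigenspace
for `4 ε_v` together with `v` spans this line, and the eigenspace for `ε_v` is its orthogonal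
complement. The conditions on `v` and `w` now say that a line is determined by each of its
non-zero vectors and that orthogonality of lines is symmetric.
-/

/-! ### Metrics and local isometries in coordinates -/

namespace SemiRiemannian

section LocalIsometry

variable {E : Type*} [NormedAddCommGroup E] [NormedSpace ℝ E]

theorem christoffel_congr {G H : E → E →L[ℝ] E →L[ℝ] ℝ} {p : E} (h : G =ᶠ[nhds p] H) :
    christoffel G =ᶠ[nhds p] christoffel H := by
  filter_upwards [h.eventuallyEq_nhds] with q hq
  rw [christoffel, christoffel, christoffelLower, christoffelLower, hq.fderiv_eq, hq.eq_of_nhds]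

theorem coordJacobi_congr {G H : E → E →L[ℝ] E →L[ℝ] ℝ} {p : E} (h : G =ᶠ[nhds p] H) (v : E) :
    coordJacobi G p v = coordJacobi H p v := by
  have h_christoffel := christoffel_congr h
  refine LinearMap.ext fun x => ?_
  change curvature G p v x v = curvature H p v x v
  rw [curvature, curvature, h_christoffel.fderiv_eq, h_christoffel.eq_of_nhds]

/-- `G` is a semi-Riemannian metric on the open subset `U` of a vector space. This is the local
counterpart of `IsMetric`, so that coordinate expressions can be handled without charts. -/
structure IsMetricOn (G : E → E →L[ℝ] E →L[ℝ] ℝ) (U : Set E) : Prop where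
  isOpen : IsOpen U
  symm : ∀ p ∈ U, ∀ v w, G p v w = G p w v
  nondegenerate : ∀ p ∈ U, ∀ v, (∀ w, G p v w = 0) → v = 0
  smooth : ContDiffOn ℝ ∞ G U

namespace IsMetricOn

variable {G : E → E →L[ℝ] E →L[ℝ] ℝ} {U : Set E} {p : E}

theorem mem_nhds (hG : IsMetricOn G U) (hp : p ∈ U) : U ∈ nhds p :=
  hG.isOpen.mem_nhds hp

theorem contDiffAt (hG : IsMetricOn G U) (hp : p ∈ U) : ContDiffAt ℝ ∞ G p :=
  hG.smooth.contDiffAt (hG.mem_nhds hp)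

theorem contDiffAt_fderiv (hG : IsMetricOn G U) (hp : p ∈ U) : ContDiffAt ℝ ∞ (fderiv ℝ G) p :=
  (hG.contDiffAt hp).fderiv_right (by simp)

theorem hasFDerivAt (hG : IsMetricOn G U) (hp : p ∈ U) : HasFDerivAt G (fderiv ℝ G p) p :=
  ((hG.contDiffAt hp).differentiableAt (by simp)).hasFDerivAt

theorem hasFDerivAt_fderiv_apply (hG : IsMetricOn G U) (hp : p ∈ U) (v w z : E) :
    HasFDerivAt (fun q => fderiv ℝ G q v w z)
      ((((fderiv ℝ (fderiv ℝ G) p).flip v).flip w).flip z) p := by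
  have h := ((hG.contDiffAt_fderiv hp).differentiableAt (by simp)).hasFDerivAt
  refine (((h.clm_apply (hasFDerivAt_const v p)).clm_apply (hasFDerivAt_const w p)).clm_apply
    (hasFDerivAt_const z p)).congr_fderiv ?_
  ext
  simp

theorem contDiffAt_christoffelLower (hG : IsMetricOn G U) (hp : p ∈ U) :
    ContDiffAt ℝ ∞ (christoffelLower G) p := by
  have h := hG.contDiffAt_fderiv hp
  have hflip : ContDiffAt ℝ ∞ (fun q => (fderiv ℝ G q).flip) p :=
    (ContinuousLinearMap.flipₗᵢ ℝ E E (E →L[ℝ] ℝ)).contDiff.contDiffAt.comp p h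
  exact (contDiffAt_const (c := (1 / 2 : ℝ))).smul ((h.add hflip).sub
    (contDiffAt_const.clm_comp hflip))

variable [FiniteDimensional ℝ E]

theorem exists_equiv (hG : IsMetricOn G U) (hp : p ∈ U) :
    ∃ e : E ≃L[ℝ] (E →L[ℝ] ℝ), (e : E →L[ℝ] E →L[ℝ] ℝ) = G p := by
  have hinj : Function.Injective (G p : E →ₗ[ℝ] E →L[ℝ] ℝ) :=
    (injective_iff_map_eq_zero _).2 fun v hv =>
      hG.nondegenerate p hp v fun w => DFunLike.congr_fun hv w
  have hfin : Module.finrank ℝ E = Module.finrank ℝ (E →L[ℝ] ℝ) := by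
    rw [← (LinearMap.toContinuousLinearMap : (E →ₗ[ℝ] ℝ) ≃ₗ[ℝ] E →L[ℝ] ℝ).finrank_eq]
    exact Subspace.dual_finrank_eq.symm
  exact ⟨(LinearEquiv.ofInjectiveOfFinrankEq _ hinj hfin).toContinuousLinearEquiv, rfl⟩

theorem apply_christoffel (hG : IsMetricOn G U) (hp : p ∈ U) (v w z : E) :
    G p (christoffel G p v w) z = christoffelLower G p v w z := by
  obtain ⟨e, he⟩ := hG.exists_equiv hp
  rw [christoffel_apply, ← he, ContinuousLinearMap.inverse_equiv]
  exact DFunLike.congr_fun (e.apply_symm_apply _) z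

theorem contDiffAt_christoffel (hG : IsMetricOn G U) (hp : p ∈ U) :
    ContDiffAt ℝ ∞ (christoffel G) p := by
  have := FiniteDimensional.complete ℝ E
  obtain ⟨e, he⟩ := hG.exists_equiv hp
  have hinverse : ContDiffAt ℝ ∞ (fun q => (G q).inverse) p := by
    have h : ContDiffAt ℝ ∞ ContinuousLinearMap.inverse (G p) := he ▸ contDiffAt_map_inverse e
    exact h.comp p (hG.contDiffAt hp)
  exact ((ContinuousLinearMap.compL ℝ E (E →L[ℝ] ℝ) E).contDiff.contDiffAt.comp p
    hinverse).clm_comp (hG.contDiffAt_christoffelLower hp)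

theorem hasFDerivAt_christoffel (hG : IsMetricOn G U) (hp : p ∈ U) :
    HasFDerivAt (christoffel G) (fderiv ℝ (christoffel G) p) p :=
  ((hG.contDiffAt_christoffel hp).differentiableAt (by simp)).hasFDerivAt

theorem christoffel_eq_zero (hG : IsMetricOn G U) (hp : p ∈ U) (h : fderiv ℝ G p = 0)
    (v w : E) : christoffel G p v w = 0 :=
  hG.nondegenerate p hp _ fun z => by
    simp [hG.apply_christoffel hp, christoffelLower_apply, h]

theorem apply_fderiv_christoffel (hG : IsMetricOn G U) (hp : p ∈ U) (h : fderiv ℝ G p = 0)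
    (x v w z : E) :
    G p (fderiv ℝ (christoffel G) p x v w) z =
      (1 / 2) * (fderiv ℝ (fderiv ℝ G) p x v w z + fderiv ℝ (fderiv ℝ G) p x w v z
        - fderiv ℝ (fderiv ℝ G) p x z v w) := by
  have hleft := ((hG.hasFDerivAt hp).clm_apply (((hG.hasFDerivAt_christoffel hp).clm_apply
    (hasFDerivAt_const v p)).clm_apply (hasFDerivAt_const w p))).clm_apply (hasFDerivAt_const z p)
  have hright := (((hG.hasFDerivAt_fderiv_apply hp v w z).add
    (hG.hasFDerivAt_fderiv_apply hp w v z)).sub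
      (hG.hasFDerivAt_fderiv_apply hp z v w)).const_mul (1 / 2)
  have hlower : (fun q => G q (christoffel G q v w) z) =ᶠ[nhds p] fun q =>
      (1 / 2) * (fderiv ℝ G q v w z + fderiv ℝ G q w v z - fderiv ℝ G q z v w) := by
    filter_upwards [hG.mem_nhds hp] with q hq
    rw [hG.apply_christoffel hq, christoffelLower_apply]
  simpa [h] using DFunLike.congr_fun (hleft.unique (hright.congr_of_eventuallyEq hlower)) x

theorem apply_coordJacobi (hG : IsMetricOn G U) (hp : p ∈ U) (h : fderiv ℝ G p = 0)
    (v x z : E) : G p (coordJacobi G p v x) z =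
      (1 / 2) * (2 * fderiv ℝ (fderiv ℝ G) p x v v z - fderiv ℝ (fderiv ℝ G) p x z v v
        - fderiv ℝ (fderiv ℝ G) p v x v z - fderiv ℝ (fderiv ℝ G) p v v x z
        + fderiv ℝ (fderiv ℝ G) p v z x v) := by
  change G p (curvature G p v x v) z = _
  simp only [curvature, hG.christoffel_eq_zero hp h, map_add, map_sub, map_zero, add_apply,
    sub_apply, zero_apply, hG.apply_fderiv_christoffel hp h]
  ring

end IsMetricOn

/-- `φ` is smooth at `y` and pulls the metric `H` back to `G` near `y`. Three derivatives are
what the transformation law of the curvature consumes. -/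
structure IsLocalIsometryAt (G H : E → E →L[ℝ] E →L[ℝ] ℝ) (φ : E → E) (y : E) : Prop where
  smooth : ContDiffAt ℝ 3 φ y
  isometric : ∀ᶠ z in nhds y, ∀ v w, G z v w = H (φ z) (fderiv ℝ φ z v) (fderiv ℝ φ z w)

namespace IsLocalIsometryAt

variable {G H K : E → E →L[ℝ] E →L[ℝ] ℝ} {U V : Set E} {φ ψ : E → E} {y : E}

theorem refl (G : E → E →L[ℝ] E →L[ℝ] ℝ) (y : E) : IsLocalIsometryAt G G id y where
  smooth := contDiffAt_id
  isometric := .of_forall fun z v w => by rw [fderiv_id]; rfl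

theorem congr (h : IsLocalIsometryAt G H φ y) (hψ : ψ =ᶠ[nhds y] φ) :
    IsLocalIsometryAt G H ψ y where
  smooth := h.smooth.congr_of_eventuallyEq hψ
  isometric := by
    filter_upwards [h.isometric, hψ.eventuallyEq_nhds] with z hz hψz v w
    rw [hz, hψz.fderiv_eq, hψz.eq_of_nhds]

theorem eventually (h : IsLocalIsometryAt G H φ y) :
    ∀ᶠ z in nhds y, IsLocalIsometryAt G H φ z := by
  filter_upwards [h.smooth.eventually (by simp), h.isometric.eventually_nhds] with z hs hi
  exact ⟨hs, hi⟩

theorem apply_fderiv (h : IsLocalIsometryAt G H φ y) (v w : E) :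
    H (φ y) (fderiv ℝ φ y v) (fderiv ℝ φ y w) = G y v w :=
  (h.isometric.self_of_nhds v w).symm

theorem hasFDerivAt (h : IsLocalIsometryAt G H φ y) : HasFDerivAt φ (fderiv ℝ φ y) y :=
  (h.smooth.differentiableAt (by simp)).hasFDerivAt

theorem contDiffAt_fderiv (h : IsLocalIsometryAt G H φ y) : ContDiffAt ℝ 2 (fderiv ℝ φ) y :=
  h.smooth.fderiv_right (by norm_num)

theorem hasFDerivAt_fderiv (h : IsLocalIsometryAt G H φ y) :
    HasFDerivAt (fderiv ℝ φ) (fderiv ℝ (fderiv ℝ φ) y) y :=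
  (h.contDiffAt_fderiv.differentiableAt (by simp)).hasFDerivAt

theorem hasFDerivAt_fderiv_fderiv (h : IsLocalIsometryAt G H φ y) :
    HasFDerivAt (fderiv ℝ (fderiv ℝ φ)) (fderiv ℝ (fderiv ℝ (fderiv ℝ φ)) y) y :=
  ((h.contDiffAt_fderiv.fderiv_right (m := 1) (by norm_num)).differentiableAt
    (by simp)).hasFDerivAt

theorem fderiv_fderiv_symm (h : IsLocalIsometryAt G H φ y) (v w : E) :
    fderiv ℝ (fderiv ℝ φ) y v w = fderiv ℝ (fderiv ℝ φ) y w v :=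
  h.smooth.isSymmSndFDerivAt (by simp [minSmoothness_of_isRCLikeNormedField]; norm_num) v w

theorem comp (hψ : IsLocalIsometryAt H K ψ (φ y)) (hφ : IsLocalIsometryAt G H φ y) :
    IsLocalIsometryAt G K (ψ ∘ φ) y where
  smooth := hψ.smooth.comp y hφ.smooth
  isometric := by
    filter_upwards [hφ.eventually, hφ.smooth.continuousAt.eventually hψ.eventually]
      with z hφz hψz v w
    rw [(hψz.hasFDerivAt.comp z hφz.hasFDerivAt).fderiv]
    exact (hφz.apply_fderiv v w).symm.trans (hψz.apply_fderiv _ _).symm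

theorem fderiv_injective (hG : IsMetricOn G U) (hy : y ∈ U) (h : IsLocalIsometryAt G H φ y) :
    Function.Injective (fderiv ℝ φ y) :=
  (injective_iff_map_eq_zero _).2 fun v hv => hG.nondegenerate y hy v fun w => by
    rw [← h.apply_fderiv, hv, map_zero, zero_apply]

theorem fderiv_metric (hG : IsMetricOn G U) (hy : y ∈ U) (hH : IsMetricOn H V) (hφ : φ y ∈ V)
    (h : IsLocalIsometryAt G H φ y) (x v w : E) :
    fderiv ℝ G y x v w =
      fderiv ℝ H (φ y) (fderiv ℝ φ y x) (fderiv ℝ φ y v) (fderiv ℝ φ y w)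
      + H (φ y) (fderiv ℝ (fderiv ℝ φ) y x v) (fderiv ℝ φ y w)
      + H (φ y) (fderiv ℝ φ y v) (fderiv ℝ (fderiv ℝ φ) y x w) := by
  have hd := h.hasFDerivAt_fderiv
  have hleft := ((hG.hasFDerivAt hy).clm_apply (hasFDerivAt_const v y)).clm_apply
    (hasFDerivAt_const w y)
  have hright := (((hH.hasFDerivAt hφ).comp y h.hasFDerivAt).clm_apply
    (hd.clm_apply (hasFDerivAt_const v y))).clm_apply (hd.clm_apply (hasFDerivAt_const w y))
  have hderiv := DFunLike.congr_fun (hleft.unique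
    (hright.congr_of_eventuallyEq (h.isometric.mono fun z hz => hz v w))) x
  simp only [ContinuousLinearMap.comp_zero, zero_add, add_apply, ContinuousLinearMap.comp_apply,
    ContinuousLinearMap.flip_apply, Function.comp_apply, ContinuousLinearMap.flip_add] at hderiv
  linarith

variable [FiniteDimensional ℝ E]

theorem fderiv_surjective (hG : IsMetricOn G U) (hy : y ∈ U) (h : IsLocalIsometryAt G H φ y) :
    Function.Surjective (fderiv ℝ φ y) :=
  (LinearMap.injective_iff_surjective (f := (fderiv ℝ φ y).toLinearMap)).1
    (h.fderiv_injective hG hy)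

theorem fderiv_christoffel (hG : IsMetricOn G U) (hy : y ∈ U) (hH : IsMetricOn H V)
    (hφ : φ y ∈ V) (h : IsLocalIsometryAt G H φ y) (v w : E) :
    fderiv ℝ φ y (christoffel G y v w) =
      christoffel H (φ y) (fderiv ℝ φ y v) (fderiv ℝ φ y w) + fderiv ℝ (fderiv ℝ φ) y v w := by
  rw [← sub_eq_zero]
  refine hH.nondegenerate _ hφ _ fun z => ?_
  obtain ⟨z, rfl⟩ := h.fderiv_surjective hG hy z
  rw [map_sub, map_add, sub_apply, add_apply, h.apply_fderiv, hG.apply_christoffel hy,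
    hH.apply_christoffel hφ, christoffelLower_apply, christoffelLower_apply,
    h.fderiv_metric hG hy hH hφ, h.fderiv_metric hG hy hH hφ, h.fderiv_metric hG hy hH hφ,
    h.fderiv_fderiv_symm w v, h.fderiv_fderiv_symm z v, h.fderiv_fderiv_symm z w,
    hH.symm _ hφ (fderiv ℝ (fderiv ℝ φ) y v z)]
  ring

theorem fderiv_fderiv_christoffel (hG : IsMetricOn G U) (hy : y ∈ U) (hH : IsMetricOn H V)
    (hφ : φ y ∈ V) (h : IsLocalIsometryAt G H φ y) (x v z : E) :
    fderiv ℝ φ y (fderiv ℝ (christoffel G) y v x z) =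
      fderiv ℝ (christoffel H) (φ y) (fderiv ℝ φ y v) (fderiv ℝ φ y x) (fderiv ℝ φ y z)
      + christoffel H (φ y) (fderiv ℝ (fderiv ℝ φ) y v x) (fderiv ℝ φ y z)
      + christoffel H (φ y) (fderiv ℝ φ y x) (fderiv ℝ (fderiv ℝ φ) y v z)
      + fderiv ℝ (fderiv ℝ (fderiv ℝ φ)) y v x z
      - fderiv ℝ (fderiv ℝ φ) y v (christoffel G y x z) := by
  have hd := h.hasFDerivAt_fderiv
  have hleft := hd.clm_apply (((hG.hasFDerivAt_christoffel hy).clm_apply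
    (hasFDerivAt_const x y)).clm_apply (hasFDerivAt_const z y))
  have hright := ((((hH.hasFDerivAt_christoffel hφ).comp y h.hasFDerivAt).clm_apply
    (hd.clm_apply (hasFDerivAt_const x y))).clm_apply (hd.clm_apply (hasFDerivAt_const z y))).add
    ((h.hasFDerivAt_fderiv_fderiv.clm_apply (hasFDerivAt_const x y)).clm_apply
      (hasFDerivAt_const z y))
  have hlaw := hright.congr_of_eventuallyEq (f₁ := fun q => fderiv ℝ φ q (christoffel G q x z)) (by
    filter_upwards [h.eventually, hG.mem_nhds hy,
      h.smooth.continuousAt.eventually (hH.mem_nhds hφ)] with q hq hqU hqV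
    exact hq.fderiv_christoffel hG hqU hH hqV x z)
  have hderiv := DFunLike.congr_fun (hleft.unique hlaw) v
  rw [eq_sub_iff_add_eq]
  simp only [ContinuousLinearMap.comp_zero, zero_add, add_apply, ContinuousLinearMap.comp_apply,
    ContinuousLinearMap.flip_apply, Function.comp_apply, ContinuousLinearMap.flip_add] at hderiv
  rw [hderiv]
  abel

theorem fderiv_curvature (hG : IsMetricOn G U) (hy : y ∈ U) (hH : IsMetricOn H V)
    (hφ : φ y ∈ V) (h : IsLocalIsometryAt G H φ y) (x v z : E) :
    fderiv ℝ φ y (curvature G y x v z) =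
      curvature H (φ y) (fderiv ℝ φ y x) (fderiv ℝ φ y v) (fderiv ℝ φ y z) := by
  have hsymm : fderiv ℝ (fderiv ℝ (fderiv ℝ φ)) y x v = fderiv ℝ (fderiv ℝ (fderiv ℝ φ)) y v x :=
    h.contDiffAt_fderiv.isSymmSndFDerivAt (by simp [minSmoothness_of_isRCLikeNormedField]) x v
  simp only [curvature, map_add, map_sub, h.fderiv_fderiv_christoffel hG hy hH hφ,
    h.fderiv_christoffel hG hy hH hφ, h.fderiv_fderiv_symm x v, hsymm]
  abel

theorem fderiv_coordJacobi (hG : IsMetricOn G U) (hy : y ∈ U) (hH : IsMetricOn H V)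
    (hφ : φ y ∈ V) (h : IsLocalIsometryAt G H φ y) (v x : E) :
    fderiv ℝ φ y (coordJacobi G y v x) = coordJacobi H (φ y) (fderiv ℝ φ y v) (fderiv ℝ φ y x) :=
  h.fderiv_curvature hG hy hH hφ v x v

end IsLocalIsometryAt

end LocalIsometry

end SemiRiemannian

/-! ### Operators with the spectrum of a special Osserman manifold -/

namespace SemiRiemannian

theorem mem_eigenspace_restrict_iff {K V : Type*} [Field K] [AddCommGroup V] [Module K V]
    {J : Module.End K V} {p : Submodule K V} {h : ∀ x ∈ p, J x ∈ p} {t : K} {x : p} :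
    x ∈ Module.End.eigenspace (J.restrict h) t ↔
      (x : V) ∈ LinearMap.ker (J - t • LinearMap.id) := by
  rw [Module.End.mem_eigenspace_iff, Subtype.ext_iff, LinearMap.mem_ker]
  exact sub_eq_zero.symm

/-- The algebraic form of the Jacobi operator `J` of a vector `v` on a special Osserman manifold,
where `ℓ` is the linear form `g(v, ·)`. If `ℓ v ≠ 0`, then `-(ℓ v)⁻¹ • D` is the projection onto one
of the two eigenspaces of `J` on `ker ℓ`. -/
structure HasOssermanForm {K V : Type*} [Field K] [AddCommGroup V] [Module K V] (l m : K)
    (ℓ : V →ₗ[K] K) (v : V) (D J : Module.End K V) : Prop where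
  apply_eq : ∀ x, J x = l • (ℓ v • x - ℓ x • v) + (l - m) • D x
  defect_self : D v = 0
  defect_defect : ∀ x, D (D x) = -ℓ v • D x
  form_defect : ∀ x, ℓ (D x) = 0

namespace HasOssermanForm

variable {K V : Type*} [Field K] [AddCommGroup V] [Module K V] {l m : K} {ℓ : V →ₗ[K] K} {v x : V}
  {D J : Module.End K V}

theorem form_apply (hJ : HasOssermanForm l m ℓ v D J) (x : V) : ℓ (J x) = 0 := by
  simp only [hJ.apply_eq, map_add, map_smul, map_sub, hJ.form_defect, smul_eq_mul]
  ring

theorem form_eq_zero_of_apply_eq (hJ : HasOssermanForm l m ℓ v D J) {t : K} (ht : t ≠ 0)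
    (h : J x = t • x) : ℓ x = 0 := by
  have h_form := hJ.form_apply x
  rw [h, map_smul, smul_eq_mul, mul_eq_zero] at h_form
  exact h_form.resolve_left ht

theorem form_eq_zero_of_defect_eq (hJ : HasOssermanForm l m ℓ v D J) (hv : ℓ v ≠ 0)
    (h : D x = -ℓ v • x) : ℓ x = 0 := by
  have h_form := hJ.form_defect x
  rw [h, map_smul, smul_eq_mul, mul_eq_zero] at h_form
  exact h_form.resolve_left (neg_ne_zero.2 hv)

theorem mem_ker_left_iff (hJ : HasOssermanForm l m ℓ v D J) (hv : ℓ v ≠ 0) (hl : l ≠ 0)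
    (hlm : l ≠ m) :
    x ∈ LinearMap.ker (J - (ℓ v * l) • LinearMap.id) ↔ ℓ x = 0 ∧ D x = 0 := by
  rw [LinearMap.mem_ker, LinearMap.sub_apply, sub_eq_zero]
  change J x = (ℓ v * l) • x ↔ _
  refine ⟨fun h => ?_, fun ⟨h_form, h_defect⟩ => ?_⟩
  · have h_form := hJ.form_eq_zero_of_apply_eq (mul_ne_zero hv hl) h
    have h_smul : (l - m) • D x = J x - (ℓ v * l) • x := by
      rw [hJ.apply_eq, h_form]
      module
    rw [h, sub_self] at h_smul
    exact ⟨h_form, (smul_eq_zero.1 h_smul).resolve_left (sub_ne_zero.2 hlm)⟩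
  · rw [hJ.apply_eq, h_form, h_defect]
    module

theorem mem_ker_right_of_defect_eq (hJ : HasOssermanForm l m ℓ v D J) (hx : ℓ x = 0)
    (h : D x = -ℓ v • x) : x ∈ LinearMap.ker (J - (ℓ v * m) • LinearMap.id) := by
  rw [LinearMap.mem_ker, LinearMap.sub_apply, hJ.apply_eq, hx, h, LinearMap.smul_apply,
    LinearMap.id_apply]
  module

theorem mem_ker_right_iff (hJ : HasOssermanForm l m ℓ v D J) (hv : ℓ v ≠ 0) (hm : m ≠ 0)
    (hlm : l ≠ m) :
    x ∈ LinearMap.ker (J - (ℓ v * m) • LinearMap.id) ↔ D x = -ℓ v • x := by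
  refine ⟨fun h => ?_, fun h =>
    hJ.mem_ker_right_of_defect_eq (hJ.form_eq_zero_of_defect_eq hv h) h⟩
  have h_apply : J x = (ℓ v * m) • x := sub_eq_zero.1 h
  have h_form := hJ.form_eq_zero_of_apply_eq (mul_ne_zero hv hm) h_apply
  have h_smul : (l - m) • (D x - -ℓ v • x) = J x - (ℓ v * m) • x := by
    rw [hJ.apply_eq, h_form]
    module
  rw [h_apply, sub_self] at h_smul
  exact sub_eq_zero.1 ((smul_eq_zero.1 h_smul).resolve_left (sub_ne_zero.2 hlm))

theorem span_sup_ker_left (hJ : HasOssermanForm l m ℓ v D J) (hv : ℓ v ≠ 0) (hl : l ≠ 0)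
    (hlm : l ≠ m) :
    Submodule.span K {v} ⊔ LinearMap.ker (J - (ℓ v * l) • LinearMap.id) = LinearMap.ker D := by
  refine le_antisymm (sup_le ?_ fun x hx => ?_) fun x hx => Submodule.mem_sup.2
    ⟨(ℓ x / ℓ v) • v, Submodule.smul_mem _ _ (Submodule.mem_span_singleton_self v),
      x - (ℓ x / ℓ v) • v, ?_, by module⟩
  · rw [Submodule.span_singleton_le_iff_mem]
    exact hJ.defect_self
  · exact ((hJ.mem_ker_left_iff hv hl hlm).1 hx).2
  · rw [hJ.mem_ker_left_iff hv hl hlm, map_sub, map_smul, map_sub, map_smul, hJ.defect_self,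
      LinearMap.mem_ker.1 hx, smul_eq_mul, div_mul_cancel₀ _ hv]
    simp

theorem finrank_ker_left [FiniteDimensional K V] (hJ : HasOssermanForm l m ℓ v D J)
    (hv : ℓ v ≠ 0) (hl : l ≠ 0) (hlm : l ≠ m) :
    Module.finrank K (LinearMap.ker (J - (ℓ v * l) • LinearMap.id)) + 1 =
      Module.finrank K (LinearMap.ker D) := by
  have hv₀ : v ≠ 0 := fun h => hv (by rw [h, map_zero])
  have h_inf : Submodule.span K {v} ⊓ LinearMap.ker (J - (ℓ v * l) • LinearMap.id) = ⊥ := by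
    refine (Submodule.eq_bot_iff _).2 fun x ⟨hx_span, hx⟩ => ?_
    obtain ⟨r, rfl⟩ := Submodule.mem_span_singleton.1 hx_span
    have h_form := ((hJ.mem_ker_left_iff hv hl hlm).1 hx).1
    rw [map_smul, smul_eq_mul, mul_eq_zero, or_iff_left hv] at h_form
    rw [h_form, zero_smul]
  have h := Submodule.finrank_sup_add_finrank_inf_eq (Submodule.span K {v})
    (LinearMap.ker (J - (ℓ v * l) • LinearMap.id))
  rw [h_inf, finrank_bot, hJ.span_sup_ker_left hv hl hlm, finrank_span_singleton hv₀] at h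
  omega

theorem finrank_ker_right [FiniteDimensional K V] (hJ : HasOssermanForm l m ℓ v D J)
    (hv : ℓ v ≠ 0) (hm : m ≠ 0) (hlm : l ≠ m) :
    Module.finrank K (LinearMap.ker (J - (ℓ v * m) • LinearMap.id)) +
      Module.finrank K (LinearMap.ker D) = Module.finrank K V := by
  have h_range : LinearMap.ker (J - (ℓ v * m) • LinearMap.id) = LinearMap.range D := by
    refine le_antisymm (fun x hx => ?_) ?_
    · rw [hJ.mem_ker_right_iff hv hm hlm] at hx
      refine ⟨(-ℓ v)⁻¹ • x, ?_⟩
      rw [map_smul, hx, inv_smul_smul₀ (neg_ne_zero.2 hv)]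
    · rintro _ ⟨x, rfl⟩
      exact (hJ.mem_ker_right_iff hv hm hlm).2 (hJ.defect_defect x)
  rw [h_range, LinearMap.finrank_range_add_finrank_ker]

theorem iSup_eigenspace_restrict (hJ : HasOssermanForm l m ℓ v D J) (hv : ℓ v ≠ 0) (hl : l ≠ 0)
    (hm : m ≠ 0) (hlm : l ≠ m) (h : ∀ x ∈ LinearMap.ker ℓ, J x ∈ LinearMap.ker ℓ) :
    ⨆ t : K, Module.End.eigenspace (J.restrict h) t = ⊤ := by
  refine eq_top_iff.2 fun x _ => ?_
  have h_form : ℓ ((-ℓ v)⁻¹ • D x) = 0 := by rw [map_smul, hJ.form_defect, smul_zero]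
  have h_defect : D ((-ℓ v)⁻¹ • D (x : V)) = D x := by
    rw [map_smul, hJ.defect_defect, inv_smul_smul₀ (neg_ne_zero.2 hv)]
  set z : LinearMap.ker ℓ := ⟨(-ℓ v)⁻¹ • D x, h_form⟩
  have hz : (z : V) ∈ LinearMap.ker (J - (ℓ v * m) • LinearMap.id) := by
    rw [hJ.mem_ker_right_iff hv hm hlm, h_defect, smul_inv_smul₀ (neg_ne_zero.2 hv)]
  have hxz : ((x - z : LinearMap.ker ℓ) : V) ∈ LinearMap.ker (J - (ℓ v * l) • LinearMap.id) := by
    rw [hJ.mem_ker_left_iff hv hl hlm]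
    exact ⟨(x - z).2, by rw [Submodule.coe_sub, map_sub, h_defect, sub_self]⟩
  rw [← sub_add_cancel x z]
  exact add_mem (Submodule.mem_iSup_of_mem _ (mem_eigenspace_restrict_iff.2 hxz))
    (Submodule.mem_iSup_of_mem _ (mem_eigenspace_restrict_iff.2 hz))

theorem eq_or_eq_of_apply_eq (hJ : HasOssermanForm l m ℓ v D J) (hx : ℓ x = 0)
    (hx₀ : x ≠ 0) {t : K} (h : J x = t • x) : t = ℓ v * l ∨ t = ℓ v * m := by
  have h_defect : (l - m) • D x = (t - ℓ v * l) • x := by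
    rw [sub_smul t, ← h, hJ.apply_eq, hx]
    module
  have h_smul : (t - ℓ v * m) • D x = 0 := by
    have h_apply := congrArg D h_defect
    rw [map_smul, map_smul, hJ.defect_defect] at h_apply
    rw [← sub_eq_zero.2 h_apply.symm]
    module
  rcases smul_eq_zero.1 h_smul with ht | hD
  · exact Or.inr (sub_eq_zero.1 ht)
  · rw [hD, smul_zero, eq_comm, smul_eq_zero, or_iff_left hx₀] at h_defect
    exact Or.inl (sub_eq_zero.1 h_defect)

theorem hasEigenvalue_restrict (hJ : HasOssermanForm l m ℓ v D J)
    (h : ∀ x ∈ LinearMap.ker ℓ, J x ∈ LinearMap.ker ℓ) {t : K} (ht : t ≠ 0)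
    (h_ker : LinearMap.ker (J - t • LinearMap.id) ≠ ⊥) :
    Module.End.HasEigenvalue (J.restrict h) t := by
  obtain ⟨x, hx, hx₀⟩ := Submodule.exists_mem_ne_zero_of_ne_bot h_ker
  have hx_form : ℓ x = 0 := hJ.form_eq_zero_of_apply_eq ht (sub_eq_zero.1 hx)
  exact Module.End.hasEigenvalue_of_hasEigenvector (x := ⟨x, hx_form⟩)
    ⟨mem_eigenspace_restrict_iff.2 hx, fun h₀ => hx₀ (congrArg Subtype.val h₀)⟩

theorem setOf_hasEigenvalue_restrict (hJ : HasOssermanForm l m ℓ v D J) (hv : ℓ v ≠ 0)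
    (hl : l ≠ 0) (hm : m ≠ 0) (h : ∀ x ∈ LinearMap.ker ℓ, J x ∈ LinearMap.ker ℓ)
    (h_left : LinearMap.ker (J - (ℓ v * l) • LinearMap.id) ≠ ⊥)
    (h_right : LinearMap.ker (J - (ℓ v * m) • LinearMap.id) ≠ ⊥) :
    {t : K | t ≠ 0 ∧ Module.End.HasEigenvalue (J.restrict h) t} = {ℓ v * l, ℓ v * m} := by
  ext t
  constructor
  · rintro ⟨-, ht⟩
    obtain ⟨x, hx, hx₀⟩ := ht.exists_hasEigenvector
    exact hJ.eq_or_eq_of_apply_eq x.2 (fun h₀ => hx₀ (Subtype.ext h₀))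
      (sub_eq_zero.1 (mem_eigenspace_restrict_iff.1 hx))
  · rintro (rfl | rfl)
    · exact ⟨mul_ne_zero hv hl, hJ.hasEigenvalue_restrict h (mul_ne_zero hv hl) h_left⟩
    · exact ⟨mul_ne_zero hv hm, hJ.hasEigenvalue_restrict h (mul_ne_zero hv hm) h_right⟩

end HasOssermanForm

/-! ### Signatures -/

variable {V : Type*} [AddCommGroup V] [Module ℝ V] [Module.Finite ℝ V]

theorem finrank_le_sigPos_of_posDef_comp {W : Type*} [AddCommGroup W] [Module ℝ W]
    {Q : QuadraticForm ℝ V} {f : W →ₗ[ℝ] V} (h : (Q.comp f).PosDef) :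
    Module.finrank ℝ W ≤ sigPos Q := by
  have h_inj : Function.Injective f := by
    refine (injective_iff_map_eq_zero f).2 fun w hw => h.anisotropic w ?_
    rw [QuadraticMap.comp_apply, hw, QuadraticMap.map_zero]
  rw [← LinearMap.finrank_range_of_inj h_inj]
  refine le_sigPos_of_posDef Q ?_
  rintro ⟨_, w, rfl⟩ hw
  exact h w (by rintro rfl; exact hw (Subtype.ext (map_zero f)))

theorem sigPos_and_sigNeg_of_eq_norm_sq_sub_norm_sq {W₁ W₂ : Type*}
    [NormedAddCommGroup W₁] [NormedSpace ℝ W₁] [FiniteDimensional ℝ W₁]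
    [NormedAddCommGroup W₂] [NormedSpace ℝ W₂] [FiniteDimensional ℝ W₂]
    {Q : QuadraticForm ℝ V} (L : V ≃ₗ[ℝ] W₁ × W₂)
    (hQ : ∀ v, Q v = ‖(L v).1‖ ^ 2 - ‖(L v).2‖ ^ 2) :
    sigPos Q = Module.finrank ℝ W₁ ∧ sigNeg Q = Module.finrank ℝ W₂ := by
  have h_pos : Module.finrank ℝ W₁ ≤ sigPos Q :=
    finrank_le_sigPos_of_posDef_comp (f := L.symm.toLinearMap ∘ₗ LinearMap.inl ℝ W₁ W₂)
      fun w hw => by simpa [hQ] using pow_pos (norm_pos_iff.2 hw) 2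
  have h_neg : Module.finrank ℝ W₂ ≤ sigNeg Q :=
    finrank_le_sigPos_of_posDef_comp (f := L.symm.toLinearMap ∘ₗ LinearMap.inr ℝ W₁ W₂)
      fun w hw => by simpa [hQ] using pow_pos (norm_pos_iff.2 hw) 2
  have h_sum := QuadraticForm.sigPos_add_sigNeg_add_radical (Q := Q)
  rw [L.finrank_eq, Module.finrank_prod] at h_sum
  omega

end SemiRiemannian

/-! ### Octonions -/

namespace Octonion

noncomputable instance : NonAssocRing Octonion where
  left_distrib := mul_add
  right_distrib := add_mul
  zero_mul := zero_mul
  mul_zero := mul_zero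
  one_mul := one_mul
  mul_one := mul_one

instance : IsScalarTower ℝ Octonion Octonion := ⟨smul_mul⟩

instance : SMulCommClass ℝ Octonion Octonion := ⟨fun r x y => (mul_smul r x y).symm⟩

instance : StarRing Octonion where
  star_involutive x := by ext <;> simp
  star_mul x y := by ext <;> simp
  star_add := star_add

instance : StarModule ℝ Octonion := ⟨star_smul⟩

instance : NormMulClass Octonion := ⟨norm_mul⟩

instance : NormOneClass Octonion := ⟨norm_one⟩

instance : NormedStarGroup Octonion := ⟨fun x => (norm_star x).le⟩

theorem star_eq (x : Octonion) : star x = (2 * re x) • (1 : Octonion) - x := by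
  ext <;> simp [re]
  ring

theorem inner_star_star (x y : Octonion) : inner ℝ (star x) (star y) = inner ℝ x y := by
  simp [inner_coord]

theorem inner_one_right (x : Octonion) : inner ℝ x 1 = re x := by
  rw [inner_eq_re, star_one, mul_one]

theorem inner_one_left (x : Octonion) : inner ℝ 1 x = re x := by
  rw [real_inner_comm, inner_one_right]

theorem inner_mul_mul_left (x y z : Octonion) :
    inner ℝ (x * y) (x * z) = ‖x‖ ^ 2 * inner ℝ y z := by
  have h := norm_add_sq_real (x * y) (x * z)
  rw [← mul_add, norm_mul, norm_mul, norm_mul, mul_pow, norm_add_sq_real] at h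
  linarith

theorem inner_mul_mul_add (x y z w : Octonion) :
    inner ℝ (x * y) (z * w) + inner ℝ (x * w) (z * y) = 2 * inner ℝ x z * inner ℝ y w := by
  have h := inner_mul_mul_left (x + z) y w
  simp only [add_mul, inner_add_left, inner_add_right, inner_mul_mul_left, norm_add_sq_real] at h
  rw [real_inner_comm (z * y)]
  linarith

theorem inner_mul_left (x y z : Octonion) : inner ℝ (x * y) z = inner ℝ y (star x * z) := by
  have h := inner_mul_mul_add x y 1 z
  rw [one_mul, one_mul, inner_one_right, real_inner_comm y] at h
  rw [star_eq, sub_mul, smul_mul, one_mul, inner_sub_right, real_inner_smul_right, ← h]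
  ring

theorem inner_mul_right (x y z : Octonion) : inner ℝ (x * y) z = inner ℝ x (z * star y) := by
  have h := inner_mul_mul_add x y z 1
  rw [mul_one, mul_one, inner_one_right] at h
  rw [star_eq, mul_sub, mul_smul, mul_one, inner_sub_right, real_inner_smul_right,
    eq_sub_of_add_eq h]
  ring

theorem re_mul_mul_star (x y z : Octonion) : re (x * (y * star z)) = inner ℝ (x * y) z := by
  rw [← inner_one_right, inner_mul_left, inner_mul_right, star_star, mul_one, inner_mul_left]

theorem star_mul_mul (x y : Octonion) : star x * (x * y) = ‖x‖ ^ 2 • y := by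
  refine ext_inner_left ℝ fun z => ?_
  rw [← inner_mul_left, inner_mul_mul_left, real_inner_smul_right]

theorem mul_star_mul' (x y : Octonion) : x * (star x * y) = ‖x‖ ^ 2 • y := by
  simpa using star_mul_mul (star x) y

theorem mul_star_self (x : Octonion) : x * star x = ‖x‖ ^ 2 • (1 : Octonion) := by
  rw [← mul_mul_star, one_mul]

theorem inner_mul_star_mul_comm (p q r s : Octonion) :
    inner ℝ (p * star q * r) s = inner ℝ (q * star p * s) r := by
  rw [inner_mul_left, star_mul, star_star, real_inner_comm]

theorem inner_mul_star_mul_reverse (p q r s : Octonion) :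
    inner ℝ (p * star q * r) s = inner ℝ (s * star r * q) p := by
  rw [inner_mul_right, inner_mul_right, star_star, real_inner_comm]

theorem mul_star_mul_add (x y z : Octonion) :
    x * star y * z + x * star z * y = (2 * inner ℝ y z) • x := by
  refine ext_inner_right ℝ fun w => ?_
  have h := inner_mul_mul_add x (star y) w (star z)
  rw [inner_star_star] at h
  rw [inner_add_left, inner_mul_right _ z, inner_mul_right _ y, h, real_inner_smul_left]
  ring

/-- The middle Moufang identity, with the right-hand side `a(xy)a` written out. -/
theorem moufang (a x y : Octonion) :
    (a * x) * (y * a) = (2 * inner ℝ a (star (x * y))) • a - ‖a‖ ^ 2 • star (x * y) := by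
  refine ext_inner_right ℝ fun z => ?_
  have h := inner_mul_mul_add a x z (star (y * a))
  have h1 : inner ℝ x (star (y * a)) = inner ℝ a (star (x * y)) := by
    rw [star_mul, star_mul, ← inner_mul_left, inner_mul_right]
  have h2 : inner ℝ (a * star (y * a)) (z * x) = ‖a‖ ^ 2 * inner ℝ (star (x * y)) z := by
    rw [star_mul, mul_star_mul', star_mul, real_inner_smul_left, inner_mul_right, star_star]
  rw [inner_mul_right, eq_sub_of_add_eq h, h1, h2, inner_sub_left, real_inner_smul_left,
    real_inner_smul_left]
  ring

theorem norm_sq_affine (a b : ℝ) (x : Octonion) :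
    ‖a • (1 : Octonion) + b • x‖ ^ 2 = a ^ 2 + 2 * a * b * re x + b ^ 2 * ‖x‖ ^ 2 := by
  rw [norm_add_sq_real, norm_smul, norm_smul, real_inner_smul_left, real_inner_smul_right,
    inner_one_left, norm_one, mul_pow, mul_pow, Real.norm_eq_abs, Real.norm_eq_abs, sq_abs, sq_abs]
  ring

theorem affine_mul_star_mul (a b c d : ℝ) (x y : Octonion) :
    ((c • (1 : Octonion) + d • x) * star (a • (1 : Octonion) + b • x)) *
      ((a • (1 : Octonion) + b • x) * y) =
    ‖a • (1 : Octonion) + b • x‖ ^ 2 • ((c • (1 : Octonion) + d • x) * y) := by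
  have h : x * (x * y) = (2 * re x) • (x * y) - ‖x‖ ^ 2 • y := by
    rw [← star_mul_mul x y, star_eq, sub_mul, smul_mul, one_mul, sub_sub_cancel]
  rw [norm_sq_affine]
  simp only [star_add, star_smul, star_one, add_mul, mul_add, smul_mul, mul_smul, one_mul,
    mul_one, mul_star_self, star_mul_mul, h]
  rw [star_eq x, sub_mul, smul_mul, one_mul]
  module

theorem mul_star_mul_affine (a b c d : ℝ) (x y : Octonion) :
    (y * star (a • (1 : Octonion) + b • x)) *
      ((a • (1 : Octonion) + b • x) * star (c • (1 : Octonion) + d • x)) =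
    ‖a • (1 : Octonion) + b • x‖ ^ 2 • (y * star (c • (1 : Octonion) + d • x)) := by
  simpa only [star_mul, star_star, star_smul] using
    congrArg star (affine_mul_star_mul a b c d x (star y))

section Calculus

variable {E : Type*} [NormedAddCommGroup E] [NormedSpace ℝ E] {n : WithTop ℕ∞}
  {f g : E → Octonion} {x : E}

theorem mulL_apply (x y : Octonion) : mulL x y = x * y := rfl

theorem starL_apply (x : Octonion) : starL x = star x := rfl

@[fun_prop]
theorem contDiffAt_fun_mul (hf : ContDiffAt ℝ n f x) (hg : ContDiffAt ℝ n g x) :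
    ContDiffAt ℝ n (fun y => f y * g y) x :=
  contDiff_mul.contDiffAt.comp x (hf.prodMk hg)

@[fun_prop]
theorem contDiffAt_fun_star (hf : ContDiffAt ℝ n f x) : ContDiffAt ℝ n (fun y => star (f y)) x :=
  starL.contDiff.contDiffAt.comp x hf

@[fun_prop]
theorem contDiffAt_fun_inv (hf : ContDiffAt ℝ n f x) (hx : f x ≠ 0) :
    ContDiffAt ℝ n (fun y => (f y)⁻¹) x :=
  (contDiffAt_inv hx).comp x hf

theorem hasFDerivAt_fun_mul {f' g' : E →L[ℝ] Octonion} (hf : HasFDerivAt f f' x)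
    (hg : HasFDerivAt g g' x) :
    HasFDerivAt (fun y => f y * g y) (mulL.precompR E (f x) g' + mulL.precompL E f' (g x)) x :=
  mulL.hasFDerivAt_of_bilinear hf hg

end Calculus

end Octonion

/-! ### The metric in affine coordinates -/

namespace OP11

open SemiRiemannian

/-- The denominator `1 + |u|² - |v|²` of the metric, as a function of the affine coordinates. -/
noncomputable def denom (y : Octonion × Octonion) : ℝ := 1 + ‖y.1‖ ^ 2 - ‖y.2‖ ^ 2

theorem denom_pos {y : Octonion × Octonion} (hy : y ∈ domain) : 0 < denom y := hy

theorem coordMetric_eq (y w z : Octonion × Octonion) : coordMetric y w z =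
    (inner ℝ ((1 - ‖y.2‖ ^ 2) • w.1 + y.1 * star y.2 * w.2) z.1
      + inner ℝ (y.2 * star y.1 * w.1 - (1 + ‖y.1‖ ^ 2) • w.2) z.2) / denom y ^ 2 := by
  rw [coordMetric_apply, coordMetricFun, Octonion.re_mul_mul_star, Octonion.re_mul_mul_star,
    Octonion.inner_mul_star_mul_comm _ _ z.2, denom]
  simp only [inner_add_left, inner_sub_left, real_inner_smul_left]
  ring

theorem coordMetric_symm (y w z : Octonion × Octonion) :
    coordMetric y w z = coordMetric y z w := by
  simp only [coordMetric_apply, coordMetricFun, real_inner_comm]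
  ring

theorem coordMetric_nondegenerate {y : Octonion × Octonion} (hy : y ∈ domain)
    (w : Octonion × Octonion) (h : ∀ z, coordMetric y w z = 0) : w = 0 := by
  have hD := denom_pos hy
  set m := y.1 * star y.2 with hm
  have hm_star : y.2 * star y.1 = star m := by simp [hm]
  have hm_norm : ‖m‖ ^ 2 = ‖y.1‖ ^ 2 * ‖y.2‖ ^ 2 := by
    rw [hm, norm_mul, norm_star, mul_pow]
  have hpair : ∀ z : Octonion × Octonion, inner ℝ ((1 - ‖y.2‖ ^ 2) • w.1 + m * w.2) z.1
      + inner ℝ (star m * w.1 - (1 + ‖y.1‖ ^ 2) • w.2) z.2 = 0 := fun z => by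
    have hz := h z
    rwa [coordMetric_eq, div_eq_zero_iff, or_iff_left (by positivity), hm_star] at hz
  have h₁ : m * w.2 = -((1 - ‖y.2‖ ^ 2) • w.1) :=
    eq_neg_of_add_eq_zero_right (ext_inner_right ℝ fun z => by simpa using hpair (z, 0))
  have h₂ : star m * w.1 = (1 + ‖y.1‖ ^ 2) • w.2 :=
    sub_eq_zero.1 (ext_inner_right ℝ fun z => by simpa using hpair (0, z))
  have hw₁ := Octonion.mul_star_mul' m w.1
  have hw₂ := Octonion.star_mul_mul m w.2
  rw [h₂, mul_smul_comm, h₁, hm_norm] at hw₁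
  rw [h₁, mul_neg, mul_smul_comm, h₂, hm_norm] at hw₂
  refine Prod.ext ((smul_eq_zero_iff_right hD.ne').1 ?_) ((smul_eq_zero_iff_right hD.ne').1 ?_)
  · rw [← neg_eq_zero, ← sub_eq_zero.2 hw₁, denom]
    module
  · rw [← neg_eq_zero, ← sub_eq_zero.2 hw₂, denom]
    module

theorem contDiff_denom {n : WithTop ℕ∞} : ContDiff ℝ n denom :=
  (contDiff_const.add (contDiff_fst.norm_sq ℝ)).sub (contDiff_snd.norm_sq ℝ)

theorem contDiffOn_coordMetric : ContDiffOn ℝ ∞ coordMetric domain := by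
  refine contDiffOn_clm_apply.2 fun w => contDiffOn_clm_apply.2 fun z y hy => ?_
  simp only [coordMetric_eq]
  refine ContDiffAt.contDiffWithinAt (ContDiffAt.div ?_ (contDiff_denom.contDiffAt.pow 2)
    (pow_ne_zero 2 (denom_pos hy).ne'))
  have h₁ : ContDiffAt ℝ ∞ (fun y : Octonion × Octonion => ‖y.1‖ ^ 2) y := contDiffAt_fst.norm_sq ℝ
  have h₂ : ContDiffAt ℝ ∞ (fun y : Octonion × Octonion => ‖y.2‖ ^ 2) y := contDiffAt_snd.norm_sq ℝ
  refine (ContDiffAt.inner ℝ ?_ contDiffAt_const).add (ContDiffAt.inner ℝ ?_ contDiffAt_const)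
  · exact ((contDiffAt_const.sub h₂).smul contDiffAt_const).add (by fun_prop)
  · exact ContDiffAt.sub (by fun_prop) ((contDiffAt_const.add h₁).smul contDiffAt_const)

theorem isMetricOn_coordMetric : IsMetricOn coordMetric domain where
  isOpen := isOpen_domain
  symm p _ v w := coordMetric_symm p v w
  nondegenerate _ hp v h := coordMetric_nondegenerate hp v h
  smooth := contDiffOn_coordMetric

end OP11

/-! ### The Veronese embedding and the isometries -/

namespace OP11

open SemiRiemannian
open Octonion (re)

/-- Hermitian `3 × 3` matrices over the octonions: the diagonal entries, followed by the entries in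
the positions `(2, 1)`, `(3, 1)` and `(2, 3)`. -/
abbrev Herm : Type := ℝ × ℝ × ℝ × Octonion × Octonion × Octonion

/-- The quadratic form `X ↦ tr (XηXη)` on Hermitian matrices, where `η = diag (1, 1, -1)`. -/
noncomputable def traceForm : Herm → ℝ := fun (a, b, c, x, y, z) =>
  a ^ 2 + b ^ 2 + c ^ 2 + 2 * (‖x‖ ^ 2 - ‖y‖ ^ 2 - ‖z‖ ^ 2)

/-- The Hermitian matrix `t t*` of a column vector `t`. -/
noncomputable def rankOne : Octonion × Octonion × Octonion → Herm := fun (p, q, r) =>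
  (‖p‖ ^ 2, ‖q‖ ^ 2, ‖r‖ ^ 2, q * star p, r * star p, q * star r)

/-- The form `|p|² + |q|² - |r|²` on homogeneous coordinates. -/
noncomputable def homogeneousForm : Octonion × Octonion × Octonion → ℝ := fun (p, q, r) =>
  ‖p‖ ^ 2 + ‖q‖ ^ 2 - ‖r‖ ^ 2

/-- The Veronese embedding of the first affine chart: the matrix `t t*` of `t = (1, u, v)`,
normalized to be a projection with respect to `diag (1, 1, -1)`. -/
noncomputable def veronese (y : Octonion × Octonion) : Herm := (denom y)⁻¹ • rankOne (1, y)

theorem rankOne_one (y : Octonion × Octonion) :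
    rankOne (1, y) = (1, ‖y.1‖ ^ 2, ‖y.2‖ ^ 2, y.1, y.2, y.1 * star y.2) := by
  simp [rankOne]

theorem hasFDerivAt_rankOne_one (y : Octonion × Octonion) :
    ∃ R : Octonion × Octonion →L[ℝ] Herm, HasFDerivAt (fun y => rankOne (1, y)) R y ∧
      ∀ w, R w = (0, 2 * inner ℝ y.1 w.1, 2 * inner ℝ y.2 w.2, w.1, w.2,
        y.1 * star w.2 + w.1 * star y.2) := by
  have h₁ : HasFDerivAt (𝕜 := ℝ) (fun y : Octonion × Octonion => y.1) _ y := hasFDerivAt_fst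
  have h₂ : HasFDerivAt (𝕜 := ℝ) (fun y : Octonion × Octonion => y.2) _ y := hasFDerivAt_snd
  have h₃ := Octonion.starL.hasFDerivAt.comp y h₂
  simp only [rankOne_one]
  refine ⟨_, (hasFDerivAt_const (1 : ℝ) y).prodMk (h₁.norm_sq.prodMk (h₂.norm_sq.prodMk
    (h₁.prodMk (h₂.prodMk (Octonion.hasFDerivAt_fun_mul h₁ h₃))))), fun w => ?_⟩
  simp [Octonion.mulL_apply, Octonion.starL_apply]

theorem hasFDerivAt_denom (y : Octonion × Octonion) :
    ∃ D : Octonion × Octonion →L[ℝ] ℝ, HasFDerivAt denom D y ∧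
      ∀ w, D w = 2 * (inner ℝ y.1 w.1 - inner ℝ y.2 w.2) := by
  have h₁ : HasFDerivAt (𝕜 := ℝ) (fun y : Octonion × Octonion => y.1) _ y := hasFDerivAt_fst
  have h₂ : HasFDerivAt (𝕜 := ℝ) (fun y : Octonion × Octonion => y.2) _ y := hasFDerivAt_snd
  refine ⟨_, ((hasFDerivAt_const (1 : ℝ) y).add h₁.norm_sq).sub h₂.norm_sq, fun w => ?_⟩
  simp [mul_sub]

theorem contDiff_rankOne_one {n : WithTop ℕ∞} :
    ContDiff ℝ n fun y : Octonion × Octonion => rankOne (1, y) := by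
  simp only [rankOne_one]
  exact contDiff_const.prodMk ((contDiff_fst.norm_sq ℝ).prodMk ((contDiff_snd.norm_sq ℝ).prodMk
    (contDiff_fst.prodMk (contDiff_snd.prodMk (contDiff_iff_contDiffAt.2 fun _ => by fun_prop)))))

theorem contDiffAt_veronese {n : WithTop ℕ∞} {y : Octonion × Octonion} (hy : y ∈ domain) :
    ContDiffAt ℝ n veronese y :=
  (contDiff_denom.contDiffAt.inv (denom_pos hy).ne').smul contDiff_rankOne_one.contDiffAt

theorem fderiv_veronese {y : Octonion × Octonion} (hy : y ∈ domain) (w : Octonion × Octonion) :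
    fderiv ℝ veronese y w =
      (denom y)⁻¹ • (0, 2 * inner ℝ y.1 w.1, 2 * inner ℝ y.2 w.2, w.1, w.2,
        y.1 * star w.2 + w.1 * star y.2)
      + (-(2 * (inner ℝ y.1 w.1 - inner ℝ y.2 w.2)) / denom y ^ 2) • rankOne (1, y) := by
  obtain ⟨R, hR, hR_apply⟩ := hasFDerivAt_rankOne_one y
  obtain ⟨D, hD, hD_apply⟩ := hasFDerivAt_denom y
  have h : HasFDerivAt veronese _ y :=
    ((hasDerivAt_inv (denom_pos hy).ne').comp_hasFDerivAt y hD).smul hR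
  rw [h.fderiv]
  simp only [add_apply, smul_apply, ContinuousLinearMap.smulRight_apply, smul_eq_mul, hR_apply,
    hD_apply]
  congr 2
  ring

theorem coordMetric_self_eq_traceForm {y : Octonion × Octonion} (hy : y ∈ domain)
    (w : Octonion × Octonion) :
    coordMetric y w w = traceForm (fderiv ℝ veronese y w) / 2 := by
  have hD : 1 + ‖y.1‖ ^ 2 - ‖y.2‖ ^ 2 ≠ 0 := (denom_pos hy).ne'
  have h_cross : inner ℝ (y.1 * star w.2) (w.1 * star y.2) =
      2 * inner ℝ y.1 w.1 * inner ℝ y.2 w.2 - inner ℝ (y.1 * star y.2 * w.2) w.1 := by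
    have h := Octonion.inner_mul_mul_add y.1 (star w.2) w.1 (star y.2)
    rw [Octonion.inner_star_star, real_inner_comm y.2 w.2,
      ← Octonion.inner_mul_right (y.1 * star y.2) w.2 w.1] at h
    linarith
  have h_left : inner ℝ (y.1 * star w.2) (y.1 * star y.2) = ‖y.1‖ ^ 2 * inner ℝ y.2 w.2 := by
    rw [Octonion.inner_mul_mul_left, Octonion.inner_star_star, real_inner_comm]
  have h_right : inner ℝ (w.1 * star y.2) (y.1 * star y.2) = ‖y.2‖ ^ 2 * inner ℝ y.1 w.1 := by
    rw [Octonion.inner_mul_right, star_star, Octonion.mul_star_mul, real_inner_smul_right,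
      real_inner_comm]
  rw [fderiv_veronese hy, rankOne_one, coordMetric_eq, denom]
  simp only [traceForm, Prod.smul_mk, smul_eq_mul, norm_add_sq_real, norm_smul,
    real_inner_smul_left, real_inner_smul_right, mul_pow, Real.norm_eq_abs, sq_abs, inner_add_left,
    inner_sub_left, norm_mul, norm_star, real_inner_self_eq_norm_sq, h_cross, h_left, h_right,
    Octonion.inner_mul_star_mul_comm y.2, real_inner_comm y.1 w.1, real_inner_comm y.2 w.2]
  field_simp
  ring

theorem isLocalIsometryAt_of_veronese {φ : Octonion × Octonion → Octonion × Octonion}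
    {y : Octonion × Octonion} (A : Herm →ₗ[ℝ] Herm) (hA : ∀ X, traceForm (A X) = traceForm X)
    (hφ : ContDiffAt ℝ 3 φ y) (hy : y ∈ domain) (hy' : φ y ∈ domain)
    (h : ∀ᶠ z in nhds y, veronese (φ z) = A (veronese z)) :
    IsLocalIsometryAt coordMetric coordMetric φ y := by
  refine ⟨hφ, ?_⟩
  filter_upwards [hφ.eventually (by simp), isOpen_domain.mem_nhds hy,
    hφ.continuousAt.eventually (isOpen_domain.mem_nhds hy'), h.eventually_nhds]
    with z hφz hz hz' hA_nhds
  have h_chain : ∀ w, fderiv ℝ veronese (φ z) (fderiv ℝ φ z w) = A (fderiv ℝ veronese z w) := by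
    have hφ_diff := hφz.differentiableAt (by simp)
    have h_eq : (veronese ∘ φ) =ᶠ[nhds z] A.toContinuousLinearMap ∘ veronese := hA_nhds
    have h_fderiv := h_eq.fderiv_eq (𝕜 := ℝ)
    rw [fderiv_comp z ((contDiffAt_veronese (n := 1) hz').differentiableAt (by simp)) hφ_diff,
      fderiv_comp z A.toContinuousLinearMap.differentiableAt
        ((contDiffAt_veronese (n := 1) hz).differentiableAt (by simp)),
      ContinuousLinearMap.fderiv] at h_fderiv
    exact fun w => congrArg (fun l => l w) h_fderiv
  have h_self : ∀ w, coordMetric z w w =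
      coordMetric (φ z) (fderiv ℝ φ z w) (fderiv ℝ φ z w) := fun w => by
    rw [coordMetric_self_eq_traceForm hz, coordMetric_self_eq_traceForm hz', h_chain, hA]
  intro v w
  have h_add := h_self (v + w)
  simp only [map_add, add_apply, ← h_self v, ← h_self w, coordMetric_symm z w v,
    coordMetric_symm (φ z) (fderiv ℝ φ z w)] at h_add
  linarith

theorem denom_aff {t : Octonion × Octonion × Octonion} (ht : t.1 ≠ 0) :
    denom (aff t) = (‖t.1‖ ^ 2)⁻¹ * homogeneousForm t := by
  have h := norm_ne_zero_iff.2 ht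
  simp only [denom, aff, homogeneousForm, norm_mul, Octonion.norm_inv]
  field_simp

theorem rankOne_one_aff {t : Octonion × Octonion × Octonion} (ht : t.1 ≠ 0)
    (h : t.2.1 * star t.1 * (t.1 * star t.2.2) = ‖t.1‖ ^ 2 • (t.2.1 * star t.2.2)) :
    rankOne (1, aff t) = (‖t.1‖ ^ 2)⁻¹ • rankOne t := by
  have h₀ := norm_ne_zero_iff.2 ht
  rw [rankOne_one]
  simp only [aff, rankOne, Octonion.inv_def, mul_smul_comm, smul_mul_assoc, star_smul, star_mul,
    star_star, h, norm_smul, norm_mul, norm_star, Prod.smul_mk, smul_eq_mul, smul_smul,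
    norm_inv, norm_pow, norm_norm, star_trivial, Prod.mk.injEq, true_and]
  refine ⟨?_, ?_, ?_, ?_⟩
  · field_simp
  · field_simp
  · field_simp
  · congr 1
    field_simp

theorem veronese_aff {t : Octonion × Octonion × Octonion} (ht : t.1 ≠ 0)
    (h : t.2.1 * star t.1 * (t.1 * star t.2.2) = ‖t.1‖ ^ 2 • (t.2.1 * star t.2.2)) :
    veronese (aff t) = (homogeneousForm t)⁻¹ • rankOne t := by
  have h₀ := norm_ne_zero_iff.2 ht
  rw [veronese, denom_aff ht, rankOne_one_aff ht h, smul_smul, mul_inv, inv_inv, mul_right_comm,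
    mul_inv_cancel₀ (pow_ne_zero 2 h₀), one_mul]

/-- A map `(1, u, v) ↦ L (u, v)` into homogeneous coordinates induces a local isometry of the affine
chart as soon as it is induced by a linear isometry `A` of the Hermitian matrices. The condition
`hL_assoc` replaces the associative law for the three entries of `L (u, v)`. -/
theorem isLocalIsometryAt_aff_comp {L : Octonion × Octonion → Octonion × Octonion × Octonion}
    {y : Octonion × Octonion} (A : Herm →ₗ[ℝ] Herm) (hA : ∀ X, traceForm (A X) = traceForm X)
    (hL : ContDiff ℝ 3 L) (hL_form : ∀ z, homogeneousForm (L z) = denom z)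
    (hL_rankOne : ∀ z, rankOne (L z) = A (rankOne (1, z)))
    (hL_assoc : ∀ z, (L z).2.1 * star (L z).1 * ((L z).1 * star (L z).2.2) =
      ‖(L z).1‖ ^ 2 • ((L z).2.1 * star (L z).2.2))
    (hy : y ∈ domain) (hLy : (L y).1 ≠ 0) :
    aff (L y) ∈ domain ∧ IsLocalIsometryAt coordMetric coordMetric (fun z => aff (L z)) y := by
  have h_mem : aff (L y) ∈ domain := by
    change 0 < denom (aff (L y))
    rw [denom_aff hLy, hL_form]
    exact mul_pos (by positivity) (denom_pos hy)
  have h_smooth : ContDiffAt ℝ 3 (fun z => aff (L z)) y := by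
    have := hL.contDiffAt (x := y)
    unfold aff
    fun_prop (disch := exact hLy)
  refine ⟨h_mem, isLocalIsometryAt_of_veronese A hA h_smooth hy h_mem ?_⟩
  filter_upwards [hL.continuous.fst.continuousAt.eventually_ne hLy] with z hz
  rw [veronese_aff hz (hL_assoc z), hL_form, hL_rankOne, veronese, map_smul]

theorem norm_sq_smul_add_smul (a b : ℝ) (x y : Octonion) :
    ‖a • x + b • y‖ ^ 2 = a ^ 2 * ‖x‖ ^ 2 + 2 * a * b * inner ℝ x y + b ^ 2 * ‖y‖ ^ 2 := by
  rw [norm_add_sq_real, norm_smul, norm_smul, real_inner_smul_left, real_inner_smul_right,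
    mul_pow, mul_pow, Real.norm_eq_abs, Real.norm_eq_abs, sq_abs, sq_abs]
  ring

section Rotation

variable {α β γ δ : ℝ}

/-- The linear map `(a, b, c) ↦ (αa + βb, γa + δb, c)` on the vectors `(1, u, v)`. -/
noncomputable def rotation (α β γ δ : ℝ) : Octonion × Octonion → Octonion × Octonion × Octonion :=
  fun (u, v) => (α • 1 + β • u, γ • 1 + δ • u, v)

/-- The action `X ↦ gXgᵀ` on Hermitian matrices of the matrix `g` of `rotation α β γ δ`. -/
noncomputable def rotationAction (α β γ δ : ℝ) : Herm →ₗ[ℝ] Herm where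
  toFun := fun (a, b, c, x, y, z) =>
    (α ^ 2 * a + 2 * α * β * re x + β ^ 2 * b, γ ^ 2 * a + 2 * γ * δ * re x + δ ^ 2 * b, c,
      (γ * α * a + 2 * γ * β * re x + δ * β * b) • (1 : Octonion) + (δ * α - γ * β) • x,
      α • y + β • star z, γ • star y + δ • z)
  map_add' X Y := by
    simp only [Prod.mk_add_mk, Octonion.re_add, star_add,
      Prod.mk.injEq]
    refine ⟨by ring, by ring, trivial, by module, by module, by module⟩
  map_smul' r X := by
    simp only [Prod.smul_fst, Prod.smul_snd, Prod.smul_mk, Octonion.re_smul, Octonion.star_smul,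
      Prod.mk.injEq, smul_eq_mul, RingHom.id_apply]
    refine ⟨by ring, by ring, trivial, by module, by module, by module⟩

theorem traceForm_rotationAction (h₁ : α ^ 2 + γ ^ 2 = 1) (h₂ : β ^ 2 + δ ^ 2 = 1)
    (h₃ : α * β + γ * δ = 0) (X : Herm) :
    traceForm (rotationAction α β γ δ X) = traceForm X := by
  obtain ⟨a, b, c, x, y, z⟩ := X
  have h : inner ℝ y (star z) = inner ℝ (star y) z := by
    rw [← Octonion.inner_star_star, star_star]
  simp only [traceForm, rotationAction, LinearMap.coe_mk, AddHom.coe_mk, norm_sq_smul_add_smul,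
    norm_star, h, norm_one, Octonion.inner_one_left, one_pow]
  generalize re x = r, ‖x‖ ^ 2 = X, ‖y‖ ^ 2 = Y, ‖z‖ ^ 2 = Z, inner ℝ (star y) z = k
  grind

theorem rankOne_rotation (y : Octonion × Octonion) :
    rankOne (rotation α β γ δ y) = rotationAction α β γ δ (rankOne (1, y)) := by
  rw [rankOne_one]
  simp only [rankOne, rotation, rotationAction, LinearMap.coe_mk, AddHom.coe_mk,
    Octonion.norm_sq_affine, Prod.mk.injEq]
  refine ⟨by ring, by ring, trivial, ?_, ?_, ?_⟩
  · simp only [star_add, Octonion.star_smul, star_one, add_mul, mul_add, smul_mul_assoc,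
      mul_smul_comm, one_mul, mul_one, Octonion.mul_star_self]
    rw [Octonion.star_eq y.1]
    module
  · simp [mul_add, mul_smul_comm]
  · simp [add_mul, smul_mul_assoc]

theorem isLocalIsometryAt_rotation (h₁ : α ^ 2 + γ ^ 2 = 1) (h₂ : β ^ 2 + δ ^ 2 = 1)
    (h₃ : α * β + γ * δ = 0) {y : Octonion × Octonion} (hy : y ∈ domain)
    (hy' : α • 1 + β • y.1 ≠ 0) :
    aff (rotation α β γ δ y) ∈ domain ∧
      IsLocalIsometryAt coordMetric coordMetric (fun z => aff (rotation α β γ δ z)) y := by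
  refine isLocalIsometryAt_aff_comp _ (traceForm_rotationAction h₁ h₂ h₃)
    (by unfold rotation; fun_prop) (fun z => ?_) rankOne_rotation
    (fun z => Octonion.affine_mul_star_mul α β γ δ z.1 (star z.2)) hy hy'
  simp only [homogeneousForm, rotation, denom, Octonion.norm_sq_affine]
  linear_combination h₁ + ‖z.1‖ ^ 2 * h₂ + 2 * re z.1 * h₃

theorem isLocalIsometryAt_transition {y : Octonion × Octonion} (hy : y ∈ domain) (h : y.1 ≠ 0) :
    IsLocalIsometryAt coordMetric coordMetric transition y := by
  have h_eq : transition = fun z => aff (rotation 0 1 1 0 z) := by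
    funext z
    simp [transition, aff, rotation]
  rw [h_eq]
  exact (isLocalIsometryAt_rotation (by norm_num) (by norm_num) (by norm_num) hy
    (by simpa using h)).2

end Rotation

section Boost

variable {α β : ℝ}

/-- The linear map `(a, b, c) ↦ (αa + βc, b, βa + αc)` on the vectors `(1, u, v)`. -/
noncomputable def boost (α β : ℝ) : Octonion × Octonion → Octonion × Octonion × Octonion :=
  fun (u, v) => (α • 1 + β • v, u, β • 1 + α • v)

/-- The action `X ↦ gXgᵀ` on Hermitian matrices of the matrix `g` of `boost α β`. -/
noncomputable def boostAction (α β : ℝ) : Herm →ₗ[ℝ] Herm where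
  toFun := fun (a, b, c, x, y, z) =>
    (α ^ 2 * a + 2 * α * β * re y + β ^ 2 * c, b, β ^ 2 * a + 2 * β * α * re y + α ^ 2 * c,
      α • x + β • z,
      (β * α * a + 2 * β ^ 2 * re y + α * β * c) • (1 : Octonion) + (α ^ 2 - β ^ 2) • y,
      β • x + α • z)
  map_add' X Y := by
    simp only [Prod.mk_add_mk, Octonion.re_add, Prod.mk.injEq]
    refine ⟨by ring, trivial, by ring, by module, by module, by module⟩
  map_smul' r X := by
    simp only [Prod.smul_fst, Prod.smul_snd, Prod.smul_mk, Octonion.re_smul, Prod.mk.injEq,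
      smul_eq_mul, RingHom.id_apply]
    refine ⟨by ring, trivial, by ring, by module, by module, by module⟩

theorem traceForm_boostAction (h : α ^ 2 - β ^ 2 = 1) (X : Herm) :
    traceForm (boostAction α β X) = traceForm X := by
  obtain ⟨a, b, c, x, y, z⟩ := X
  simp only [traceForm, boostAction, LinearMap.coe_mk, AddHom.coe_mk, norm_sq_smul_add_smul,
    norm_one, Octonion.inner_one_left, one_pow]
  generalize re y = r, ‖x‖ ^ 2 = X, ‖y‖ ^ 2 = Y, ‖z‖ ^ 2 = Z, inner ℝ x z = k
  grind

theorem rankOne_boost (y : Octonion × Octonion) :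
    rankOne (boost α β y) = boostAction α β (rankOne (1, y)) := by
  rw [rankOne_one]
  simp only [rankOne, boost, boostAction, LinearMap.coe_mk, AddHom.coe_mk,
    Octonion.norm_sq_affine, Prod.mk.injEq]
  refine ⟨by ring, trivial, by ring, ?_, ?_, ?_⟩
  · simp [mul_add, mul_smul_comm]
  · simp only [star_add, Octonion.star_smul, star_one, add_mul, mul_add, smul_mul_assoc,
      mul_smul_comm, one_mul, mul_one, Octonion.mul_star_self]
    rw [Octonion.star_eq y.2]
    module
  · simp [mul_add, mul_smul_comm]

theorem isLocalIsometryAt_boost (h : α ^ 2 - β ^ 2 = 1) {y : Octonion × Octonion}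
    (hy : y ∈ domain) (hy' : α • 1 + β • y.2 ≠ 0) :
    aff (boost α β y) ∈ domain ∧
      IsLocalIsometryAt coordMetric coordMetric (fun z => aff (boost α β z)) y := by
  refine isLocalIsometryAt_aff_comp _ (traceForm_boostAction h) (by unfold boost; fun_prop)
    (fun z => ?_) rankOne_boost
    (fun z => Octonion.mul_star_mul_affine α β β α z.2 z.1) hy hy'
  simp only [homogeneousForm, boost, denom, Octonion.norm_sq_affine]
  linear_combination (1 - ‖z.2‖ ^ 2) * h

end Boost

section Twist

variable {a : Octonion}

/-- The map `(1, u, v) ↦ (1, au, āv)`. -/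
noncomputable def twist (a : Octonion) : Octonion × Octonion → Octonion × Octonion × Octonion :=
  fun (u, v) => (1, a * u, star a * v)

/-- The action on Hermitian matrices that corresponds to `twist a`; the last entry is `a z a`. -/
noncomputable def twistAction (a : Octonion) : Herm →ₗ[ℝ] Herm where
  toFun := fun (b, c, d, x, y, z) =>
    (b, c, d, a * x, star a * y, (2 * inner ℝ a (star z)) • a + (-1 : ℝ) • star z)
  map_add' X Y := by
    simp only [Prod.mk_add_mk, star_add, mul_add, Prod.mk.injEq,
      inner_add_right, true_and]
    module
  map_smul' r X := by
    simp only [Prod.smul_fst, Prod.smul_snd, Prod.smul_mk, Octonion.star_smul, mul_smul_comm,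
      Prod.mk.injEq, inner_smul_right, true_and, RingHom.id_apply]
    module

theorem traceForm_twistAction (ha : ‖a‖ = 1) (X : Herm) :
    traceForm (twistAction a X) = traceForm X := by
  simp only [traceForm, twistAction, LinearMap.coe_mk, AddHom.coe_mk, norm_sq_smul_add_smul,
    norm_star, norm_mul, ha]
  ring

theorem rankOne_twist (ha : ‖a‖ = 1) (y : Octonion × Octonion) :
    rankOne (twist a y) = twistAction a (rankOne (1, y)) := by
  rw [rankOne_one]
  simp only [rankOne, twist, twistAction, LinearMap.coe_mk, AddHom.coe_mk, norm_mul,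
    norm_star, ha, norm_one, one_pow, one_mul, star_one, mul_one, star_mul, star_star,
    Octonion.moufang, one_smul, neg_one_smul, sub_eq_add_neg]

theorem isLocalIsometryAt_twist (ha : ‖a‖ = 1) {y : Octonion × Octonion} (hy : y ∈ domain) :
    aff (twist a y) ∈ domain ∧
      IsLocalIsometryAt coordMetric coordMetric (fun z => aff (twist a z)) y :=
  isLocalIsometryAt_aff_comp _ (traceForm_twistAction ha) (contDiff_iff_contDiffAt.2 fun _ => by
    unfold twist; fun_prop) (fun z => by simp [homogeneousForm, twist, denom, ha])
    (rankOne_twist ha) (fun z => by simp [twist]) hy Octonion.one_ne_zero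

end Twist

end OP11

/-! ### Transitivity -/

namespace OP11

open SemiRiemannian

/-- The relation that some local isometry of `coordMetric` takes the point `y` to the point `z`. -/
def IsLocallyIsometric (y z : Octonion × Octonion) : Prop :=
  ∃ φ, IsLocalIsometryAt coordMetric coordMetric φ y ∧ φ y = z

theorem IsLocallyIsometric.trans {x y z : Octonion × Octonion} (hxy : IsLocallyIsometric x y)
    (hyz : IsLocallyIsometric y z) : IsLocallyIsometric x z := by
  obtain ⟨φ, hφ, rfl⟩ := hxy
  obtain ⟨ψ, hψ, rfl⟩ := hyz
  exact ⟨ψ ∘ φ, hψ.comp hφ, rfl⟩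

theorem exists_norm_eq_one_mul_eq (x : Octonion) :
    ∃ a : Octonion, ‖a‖ = 1 ∧ a * x = ‖x‖ • (1 : Octonion) := by
  by_cases hx : x = 0
  · exact ⟨1, norm_one, by simp [hx]⟩
  · have h : ‖x‖ ≠ 0 := norm_ne_zero_iff.2 hx
    refine ⟨‖x‖⁻¹ • star x, by simp [norm_smul, h], ?_⟩
    have h_star := Octonion.mul_star_self (star x)
    rw [star_star, norm_star] at h_star
    rw [smul_mul_assoc, h_star, smul_smul]
    field_simp

theorem aff_twist (a : Octonion) (y : Octonion × Octonion) :
    aff (twist a y) = (a * y.1, star a * y.2) := by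
  simp [aff, twist, Octonion.inv_one]

theorem exists_isLocallyIsometric_fst_eq_smul_one {y : Octonion × Octonion} (hy : y ∈ domain) :
    ∃ z ∈ domain, IsLocallyIsometric y z ∧ ∃ r : ℝ, z.1 = r • 1 := by
  obtain ⟨a, ha, hay⟩ := exists_norm_eq_one_mul_eq y.1
  obtain ⟨h_mem, h_iso⟩ := isLocalIsometryAt_twist ha hy
  exact ⟨_, h_mem, ⟨_, h_iso, rfl⟩, ‖y.1‖, by rw [aff_twist, hay]⟩

theorem exists_isLocallyIsometric_fst_eq_zero {y : Octonion × Octonion} (hy : y ∈ domain) {r : ℝ}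
    (hr : y.1 = r • 1) : ∃ z ∈ domain, IsLocallyIsometric y z ∧ z.1 = 0 := by
  have hr_pos : 0 < 1 + r ^ 2 := by positivity
  set k := √(1 + r ^ 2)
  have hk : 0 < k := Real.sqrt_pos.2 hr_pos
  have hk_sq : k ^ 2 = 1 + r ^ 2 := Real.sq_sqrt hr_pos.le
  have h_ne : k⁻¹ • 1 + (r * k⁻¹) • y.1 ≠ 0 := by
    rw [hr, smul_smul, ← add_smul]
    have : k⁻¹ + r * k⁻¹ * r = (1 + r ^ 2) * k⁻¹ := by ring
    exact smul_ne_zero (this ▸ by positivity) Octonion.one_ne_zero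
  obtain ⟨h_mem, h_iso⟩ := isLocalIsometryAt_rotation (α := k⁻¹) (β := r * k⁻¹) (γ := -r * k⁻¹)
    (δ := k⁻¹) (by field_simp; linarith) (by field_simp; linarith) (by ring) hy h_ne
  refine ⟨_, h_mem, ⟨_, h_iso, rfl⟩, ?_⟩
  have h_zero : (-r * k⁻¹) • (1 : Octonion) + k⁻¹ • y.1 = 0 := by
    rw [hr]
    module
  simp only [aff, rotation, h_zero, zero_mul]

theorem exists_isLocallyIsometric_snd_eq_smul_one {y : Octonion × Octonion} (hy : y ∈ domain)
    (h₁ : y.1 = 0) :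
    ∃ z ∈ domain, IsLocallyIsometric y z ∧ z.1 = 0 ∧ ∃ t : ℝ, z.2 = t • 1 := by
  obtain ⟨b, hb, hby⟩ := exists_norm_eq_one_mul_eq y.2
  obtain ⟨h_mem, h_iso⟩ := isLocalIsometryAt_twist (a := star b) (by rwa [norm_star]) hy
  refine ⟨_, h_mem, ⟨_, h_iso, rfl⟩, ?_, ‖y.2‖, ?_⟩
  · rw [aff_twist, h₁, mul_zero]
  · rw [aff_twist, star_star, hby]

theorem isLocallyIsometric_zero_of_eq {y : Octonion × Octonion} (hy : y ∈ domain) {t : ℝ}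
    (h₁ : y.1 = 0) (h₂ : y.2 = t • 1) : IsLocallyIsometric y 0 := by
  have ht : 0 < 1 - t ^ 2 := by
    have h := denom_pos hy
    simpa [denom, h₁, h₂, norm_smul] using h
  set l := √(1 - t ^ 2)
  have hl : 0 < l := Real.sqrt_pos.2 ht
  have hl_sq : l ^ 2 = 1 - t ^ 2 := Real.sq_sqrt ht.le
  have h_ne : l⁻¹ • 1 + (-t * l⁻¹) • y.2 ≠ 0 := by
    rw [h₂, smul_smul, ← add_smul]
    have : l⁻¹ + -t * l⁻¹ * t = (1 - t ^ 2) * l⁻¹ := by ring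
    exact smul_ne_zero (this ▸ by positivity) Octonion.one_ne_zero
  obtain ⟨-, h_iso⟩ := isLocalIsometryAt_boost (α := l⁻¹) (β := -t * l⁻¹)
    (by field_simp; linarith) hy h_ne
  refine ⟨_, h_iso, ?_⟩
  have h_zero : (-t * l⁻¹) • (1 : Octonion) + l⁻¹ • y.2 = 0 := by
    rw [h₂]
    module
  simp only [aff, boost, h_zero, h₁, zero_mul]
  rfl

theorem isLocallyIsometric_zero {y : Octonion × Octonion} (hy : y ∈ domain) :
    IsLocallyIsometric y 0 := by
  obtain ⟨y₁, hy₁, h₁, r, hr⟩ := exists_isLocallyIsometric_fst_eq_smul_one hy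
  obtain ⟨y₂, hy₂, h₂, h_fst⟩ := exists_isLocallyIsometric_fst_eq_zero hy₁ hr
  obtain ⟨y₃, hy₃, h₃, h_fst', t, ht⟩ := exists_isLocallyIsometric_snd_eq_smul_one hy₂ h_fst
  exact h₁.trans (h₂.trans (h₃.trans (isLocallyIsometric_zero_of_eq hy₃ h_fst' ht)))

/-! ### The Jacobi operator at the origin -/

/-- The polar form of the quadratic part of the numerator of `coordMetric`, which is also the
derivative of this numerator at the point `y` in the direction `x`. -/
noncomputable def numeratorPolar (y x w z : Octonion × Octonion) : ℝ :=
  inner ℝ ((y.1 * star x.2 + x.1 * star y.2) * w.2) z.1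
    + inner ℝ ((y.1 * star x.2 + x.1 * star y.2) * z.2) w.1
    - 2 * inner ℝ y.2 x.2 * inner ℝ w.1 z.1 - 2 * inner ℝ y.1 x.1 * inner ℝ w.2 z.2

theorem numeratorPolar_smul (r : ℝ) (y x w z : Octonion × Octonion) :
    numeratorPolar (r • y) x w z = r * numeratorPolar y x w z := by
  simp only [numeratorPolar, Prod.smul_fst, Prod.smul_snd, smul_mul_assoc, Octonion.star_smul,
    mul_smul_comm, ← smul_add, real_inner_smul_left]
  ring

theorem hasFDerivAt_numerator (y w z : Octonion × Octonion) :
    ∃ N : Octonion × Octonion →L[ℝ] ℝ, HasFDerivAt (fun q : Octonion × Octonion =>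
        (1 - ‖q.2‖ ^ 2) * inner ℝ w.1 z.1 - (1 + ‖q.1‖ ^ 2) * inner ℝ w.2 z.2
          + (inner ℝ (q.1 * star q.2 * w.2) z.1 + inner ℝ (q.1 * star q.2 * z.2) w.1)) N y ∧
      ∀ x, N x = numeratorPolar y x w z := by
  have h₁ : HasFDerivAt (𝕜 := ℝ) (fun y : Octonion × Octonion => y.1) _ y := hasFDerivAt_fst
  have h₂ : HasFDerivAt (𝕜 := ℝ) (fun y : Octonion × Octonion => y.2) _ y := hasFDerivAt_snd
  have h_inner (w z : Octonion) : HasFDerivAt (𝕜 := ℝ) (fun y : Octonion × Octonion =>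
      (inner ℝ (y.1 * star y.2 * w) z : ℝ)) _ y :=
    (Octonion.hasFDerivAt_fun_mul (Octonion.hasFDerivAt_fun_mul h₁
      (Octonion.starL.hasFDerivAt.comp y h₂)) (hasFDerivAt_const w y)).inner ℝ
        (hasFDerivAt_const z y)
  refine ⟨_, (((h₂.norm_sq.const_sub 1).mul_const _).sub ((h₁.norm_sq.const_add 1).mul_const _)).add
    ((h_inner w.2 z.1).add (h_inner z.2 w.1)), fun x => ?_⟩
  simp [Octonion.mulL_apply, Octonion.starL_apply, numeratorPolar, add_mul, inner_add_left]
  ring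

theorem fderiv_coordMetric {y : Octonion × Octonion} (hy : y ∈ domain)
    (x w z : Octonion × Octonion) : fderiv ℝ coordMetric y x w z =
      numeratorPolar y x w z / denom y ^ 2
        - 4 * coordMetric y w z * (inner ℝ y.1 x.1 - inner ℝ y.2 x.2) / denom y := by
  have hD := (denom_pos hy).ne'
  obtain ⟨N, hN, hN_apply⟩ := hasFDerivAt_numerator y w z
  obtain ⟨D, hD_deriv, hD_apply⟩ := hasFDerivAt_denom y
  have h_metric := ((isMetricOn_coordMetric.hasFDerivAt hy).clm_apply
    (hasFDerivAt_const w y)).clm_apply (hasFDerivAt_const z y)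
  have h_numerator := (h_metric.mul (hD_deriv.pow 2)).congr_of_eventuallyEq
    (f₁ := fun q : Octonion × Octonion => (1 - ‖q.2‖ ^ 2) * inner ℝ w.1 z.1
      - (1 + ‖q.1‖ ^ 2) * inner ℝ w.2 z.2
      + (inner ℝ (q.1 * star q.2 * w.2) z.1 + inner ℝ (q.1 * star q.2 * z.2) w.1)) (by
    filter_upwards [isOpen_domain.mem_nhds hy] with q hq
    have hq' : denom q ≠ 0 := (denom_pos hq).ne'
    simp only [Pi.mul_apply, coordMetric_apply, coordMetricFun, Octonion.re_mul_mul_star]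
    rw [← denom]
    field_simp)
  have h_unique := congrArg (fun l => l x) (h_numerator.unique hN)
  have h_eq : numeratorPolar y x w z = denom y ^ 2 * fderiv ℝ coordMetric y x w z
      + 4 * denom y * coordMetric y w z * (inner ℝ y.1 x.1 - inner ℝ y.2 x.2) := by
    rw [← hN_apply, ← h_unique]
    simp [hD_apply]
    ring
  rw [h_eq]
  field_simp
  ring

theorem zero_mem_domain : (0 : Octonion × Octonion) ∈ domain := by
  simp [domain]

theorem denom_zero : denom 0 = 1 := by simp [denom]

theorem coordMetric_zero (w z : Octonion × Octonion) :
    coordMetric 0 w z = inner ℝ w.1 z.1 - inner ℝ w.2 z.2 := by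
  simp [coordMetric_eq, denom_zero, sub_eq_add_neg]

theorem fderiv_coordMetric_zero : fderiv ℝ coordMetric 0 = 0 := by
  refine ContinuousLinearMap.ext fun x => ContinuousLinearMap.ext fun w =>
    ContinuousLinearMap.ext fun z => ?_
  have h := numeratorPolar_smul 0 0 x w z
  rw [zero_smul, zero_mul] at h
  simp [fderiv_coordMetric zero_mem_domain, h]

theorem hasDerivAt_zero_id_mul {h : ℝ → ℝ} (hh : ContinuousAt h 0) :
    HasDerivAt (fun s => s * h s) (h 0) 0 := by
  rw [hasDerivAt_iff_tendsto_slope]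
  refine (hh.tendsto.mono_left nhdsWithin_le_nhds).congr' ?_
  filter_upwards [self_mem_nhdsWithin] with s hs
  simp [slope_def_field, mul_div_cancel_left₀ _ (show s ≠ 0 from hs)]

theorem fderiv_fderiv_coordMetric_zero (y x w z : Octonion × Octonion) :
    fderiv ℝ (fderiv ℝ coordMetric) 0 y x w z = numeratorPolar y x w z
      - 4 * coordMetric 0 w z * (inner ℝ y.1 x.1 - inner ℝ y.2 x.2) := by
  have h_line : HasDerivAt (fun s : ℝ => s • y) y 0 := by
    simpa using (hasDerivAt_id (0 : ℝ)).smul_const y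
  have h_denom : ContinuousAt (fun s : ℝ => denom (s • y)) 0 :=
    (contDiff_denom (n := 0)).continuous.continuousAt.comp h_line.continuousAt
  have h_metric : ContinuousAt (fun s : ℝ => coordMetric (s • y) w z) 0 := by
    have h := (isMetricOn_coordMetric.hasFDerivAt zero_mem_domain).continuousAt.comp_of_eq
      h_line.continuousAt (zero_smul ℝ y)
    exact (h.clm_apply continuousAt_const).clm_apply continuousAt_const
  have h_ne : denom ((0 : ℝ) • y) ≠ 0 := by simp [denom_zero]
  have h_quot : HasDerivAt (fun s : ℝ => s * (numeratorPolar y x w z / denom (s • y) ^ 2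
      - 4 * coordMetric (s • y) w z * (inner ℝ y.1 x.1 - inner ℝ y.2 x.2) / denom (s • y))) _ 0 :=
    hasDerivAt_zero_id_mul ((continuousAt_const.div (h_denom.pow 2) (pow_ne_zero 2 h_ne)).sub
      (((continuousAt_const.mul h_metric).mul continuousAt_const).div h_denom h_ne))
  have h_eq : (fun s : ℝ => fderiv ℝ coordMetric (s • y) x w z) =ᶠ[nhds 0] fun s : ℝ =>
      s * (numeratorPolar y x w z / denom (s • y) ^ 2
        - 4 * coordMetric (s • y) w z * (inner ℝ y.1 x.1 - inner ℝ y.2 x.2) / denom (s • y)) := by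
    filter_upwards [h_line.continuousAt.eventually (isOpen_domain.mem_nhds
      (by simpa using zero_mem_domain))] with s hs
    rw [fderiv_coordMetric hs, numeratorPolar_smul]
    simp only [Prod.smul_fst, Prod.smul_snd, real_inner_smul_left]
    ring
  have h_comp := HasFDerivAt.comp_hasDerivAt_of_eq (0 : ℝ)
    (isMetricOn_coordMetric.hasFDerivAt_fderiv_apply zero_mem_domain x w z) h_line (by simp)
  simpa [denom_zero] using h_comp.unique (h_quot.congr_of_eventuallyEq h_eq)

/-- The part of the Jacobi operator of `v` at the origin that is not forced by its symmetries. Up to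
the factor `-coordMetric 0 v v` it is the projection along the octonionic line through `v` onto the
orthogonal complement of this line. -/
noncomputable def defect (v : Octonion × Octonion) : Module.End ℝ (Octonion × Octonion) where
  toFun x := (‖v.2‖ ^ 2 • x.1 - v.1 * star v.2 * x.2, v.2 * star v.1 * x.1 - ‖v.1‖ ^ 2 • x.2)
  map_add' x y := by
    simp only [Prod.fst_add, Prod.snd_add, mul_add, Prod.mk_add_mk, Prod.mk.injEq]
    constructor <;> module
  map_smul' r x := by
    simp only [Prod.smul_fst, Prod.smul_snd, mul_smul_comm, Prod.smul_mk, Prod.mk.injEq,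
      RingHom.id_apply]
    constructor <;> module

theorem defect_apply (v x : Octonion × Octonion) : defect v x =
    (‖v.2‖ ^ 2 • x.1 - v.1 * star v.2 * x.2, v.2 * star v.1 * x.1 - ‖v.1‖ ^ 2 • x.2) := rfl

theorem coordJacobi_zero (v x : Octonion × Octonion) :
    coordJacobi coordMetric 0 v x =
      (4 : ℝ) • (coordMetric 0 v v • x - coordMetric 0 v x • v) + (3 : ℝ) • defect v x := by
  rw [← sub_eq_zero]
  refine coordMetric_nondegenerate zero_mem_domain _ fun z => ?_
  rw [map_sub, sub_apply,
    isMetricOn_coordMetric.apply_coordJacobi zero_mem_domain fderiv_coordMetric_zero]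
  simp only [fderiv_fderiv_coordMetric_zero, numeratorPolar, coordMetric_zero, defect_apply]
  obtain ⟨⟨a, b⟩, ⟨c, d⟩, ⟨e, f⟩⟩ := v, x, z
  have h_swap (p q r s : Octonion) : inner ℝ (p * star q * r) s =
      2 * inner ℝ q r * inner ℝ p s - inner ℝ (p * star r * q) s := by
    have h := congrArg (fun t => inner ℝ t s) (Octonion.mul_star_mul_add p q r)
    simp only [inner_add_left, real_inner_smul_left] at h
    linarith
  have h_mid (p q s : Octonion) : inner ℝ (p * star q * q) s = ‖q‖ ^ 2 * inner ℝ p s := by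
    rw [Octonion.mul_star_mul, real_inner_smul_left]
  have h_out (p q r : Octonion) : inner ℝ (p * star q * r) p = ‖p‖ ^ 2 * inner ℝ q r := by
    rw [Octonion.inner_mul_star_mul_comm, h_mid, real_inner_comm]
  simp only [add_mul, inner_add_left, inner_sub_left, real_inner_smul_left, h_mid, h_out,
    Octonion.inner_mul_star_mul_reverse c, Octonion.inner_mul_star_mul_reverse e,
    h_swap a d b, h_swap a f b, Octonion.inner_mul_star_mul_comm b a, Prod.fst_add, Prod.snd_add,
    Prod.fst_sub, Prod.snd_sub, Prod.smul_fst, Prod.smul_snd, real_inner_self_eq_norm_sq,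
    real_inner_comm a c, real_inner_comm b d, real_inner_comm b f, real_inner_comm d f,
    real_inner_comm c e]
  ring

end OP11

/-! ### Octonionic lines -/

theorem Octonion.finrank_eq : Module.finrank ℝ Octonion = 8 := by
  rw [equivProd.finrank_eq, Module.finrank_prod, Quaternion.finrank_eq_four]

namespace OP11

open SemiRiemannian

/-- The slope `b a⁻¹` of the octonionic line `{(c, (b a⁻¹) c)}` through `(a, b)`. It is `0`
if `a = 0`; the slope of the line over the second coordinate is `lineSlope (b, a)`. -/
noncomputable def lineSlope (v : Octonion × Octonion) : Octonion := v.2 * v.1⁻¹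

variable {v w x : Octonion × Octonion}

theorem lineSlope_mul (v : Octonion × Octonion) (c : Octonion) :
    lineSlope v * c = (1 / ‖v.1‖ ^ 2) • (v.2 * star v.1 * c) := by
  rw [lineSlope, Octonion.inv_def, mul_smul_comm, smul_mul_assoc, one_div]

theorem star_lineSlope_mul (v : Octonion × Octonion) (d : Octonion) :
    star (lineSlope v) * d = (1 / ‖v.1‖ ^ 2) • (v.1 * star v.2 * d) := by
  rw [lineSlope, Octonion.inv_def, mul_smul_comm, Octonion.star_smul, star_mul, star_star,
    smul_mul_assoc, one_div]

theorem lineSlope_mul_fst (hv : v.1 ≠ 0) : lineSlope v * v.1 = v.2 :=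
  Octonion.mul_inv_mul hv v.2

theorem lineSlope_eq_of_snd_eq {s : Octonion} (hv : v.1 ≠ 0) (h : v.2 = s * v.1) :
    lineSlope v = s := by
  rw [lineSlope, h, Octonion.mul_mul_inv hv]

theorem coordMetric_zero_self (v : Octonion × Octonion) :
    coordMetric 0 v v = ‖v.1‖ ^ 2 - ‖v.2‖ ^ 2 := by
  rw [coordMetric_zero, real_inner_self_eq_norm_sq, real_inner_self_eq_norm_sq]

theorem coordMetric_zero_swap (v x : Octonion × Octonion) :
    coordMetric 0 v.swap x.swap = -coordMetric 0 v x := by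
  simp [coordMetric_zero]

theorem defect_swap (v x : Octonion × Octonion) : defect v.swap x.swap = -(defect v x).swap := by
  simp [defect_apply]

theorem defect_swap_eq_zero_iff : defect v.swap x.swap = 0 ↔ defect v x = 0 := by
  rw [defect_swap, neg_eq_zero, ← Prod.swap_inj (q := 0)]
  rfl

theorem defect_swap_eq_iff :
    defect v.swap x.swap = -coordMetric 0 v.swap v.swap • x.swap ↔
      defect v x = -coordMetric 0 v v • x := by
  rw [defect_swap, coordMetric_zero_swap, neg_neg, neg_eq_iff_eq_neg, ← neg_smul,
    ← Prod.smul_swap, Prod.swap_inj]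

theorem defect_eq_smul_lineSlope (hv : v.1 ≠ 0) (x : Octonion × Octonion) :
    defect v x = ‖v.1‖ ^ 2 •
      (‖lineSlope v‖ ^ 2 • x.1 - star (lineSlope v) * x.2, lineSlope v * x.1 - x.2) := by
  have h_ne : ‖v.1‖ ^ 2 ≠ 0 := pow_ne_zero 2 (norm_ne_zero_iff.2 hv)
  have h_norm : ‖v.2‖ ^ 2 = ‖v.1‖ ^ 2 * ‖lineSlope v‖ ^ 2 := by
    rw [← lineSlope_mul_fst hv, norm_mul, mul_pow, mul_comm]
  rw [lineSlope_mul, star_lineSlope_mul, defect_apply, h_norm, Prod.smul_mk, smul_sub, smul_sub,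
    smul_smul, smul_smul, smul_smul, mul_one_div_cancel h_ne, one_smul, one_smul]

theorem coordMetric_zero_self_eq_mul (hv : v.1 ≠ 0) :
    coordMetric 0 v v = ‖v.1‖ ^ 2 * (1 - ‖lineSlope v‖ ^ 2) := by
  rw [coordMetric_zero_self, ← lineSlope_mul_fst hv, norm_mul]
  ring

theorem defect_eq_zero_iff (hv : v.1 ≠ 0) : defect v x = 0 ↔ x.2 = lineSlope v * x.1 := by
  have h_ne : ‖v.1‖ ^ 2 ≠ 0 := pow_ne_zero 2 (norm_ne_zero_iff.2 hv)
  rw [defect_eq_smul_lineSlope hv, smul_eq_zero_iff_right h_ne, Prod.mk_eq_zero, sub_eq_zero,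
    sub_eq_zero, eq_comm (a := lineSlope v * x.1), and_iff_right_iff_imp]
  intro h
  rw [h, Octonion.star_mul_mul]

theorem defect_eq_iff (hv : v.1 ≠ 0) :
    defect v x = -coordMetric 0 v v • x ↔ x.1 = star (lineSlope v) * x.2 := by
  have h_ne : ‖v.1‖ ^ 2 ≠ 0 := pow_ne_zero 2 (norm_ne_zero_iff.2 hv)
  have h_sub : defect v x - -coordMetric 0 v v • x = ‖v.1‖ ^ 2 •
      (x.1 - star (lineSlope v) * x.2, lineSlope v * x.1 - ‖lineSlope v‖ ^ 2 • x.2) := by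
    rw [defect_eq_smul_lineSlope hv, coordMetric_zero_self_eq_mul hv]
    ext1 <;> simp only [Prod.fst_sub, Prod.snd_sub, Prod.smul_fst, Prod.smul_snd] <;> module
  rw [← sub_eq_zero, h_sub, smul_eq_zero_iff_right h_ne, Prod.mk_eq_zero, sub_eq_zero, sub_eq_zero,
    and_iff_left_iff_imp]
  intro h
  rw [h, Octonion.mul_star_mul']

theorem coordMetric_zero_eq_zero_iff (hv : coordMetric 0 v v ≠ 0) (hv₁ : v.1 ≠ 0)
    (hx : defect v x = 0) : coordMetric 0 v x = 0 ↔ inner ℝ x.1 v.1 = 0 := by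
  have h : coordMetric 0 v x = (1 - ‖lineSlope v‖ ^ 2) * inner ℝ x.1 v.1 := by
    rw [coordMetric_zero, (defect_eq_zero_iff hv₁).1 hx, ← lineSlope_mul_fst hv₁,
      Octonion.inner_mul_left, Octonion.star_mul_mul, real_inner_smul_right, real_inner_comm]
    ring
  rw [coordMetric_zero_self_eq_mul hv₁] at hv
  rw [h, mul_eq_zero, or_iff_right (right_ne_zero_of_mul hv)]

theorem coordMetric_and_defect_eq_zero_iff_of_fst_ne_zero (hv : coordMetric 0 v v ≠ 0)
    (hv₁ : v.1 ≠ 0) :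
    coordMetric 0 v x = 0 ∧ defect v x = 0 ↔
      ∃ c : Octonion, inner ℝ c v.1 = 0 ∧ x = (c, (1 / ‖v.1‖ ^ 2) • (v.2 * star v.1 * c)) := by
  simp only [← lineSlope_mul]
  constructor
  · rintro ⟨h_form, h_defect⟩
    exact ⟨x.1, (coordMetric_zero_eq_zero_iff hv hv₁ h_defect).1 h_form,
      Prod.ext rfl ((defect_eq_zero_iff hv₁).1 h_defect)⟩
  · rintro ⟨c, hc, rfl⟩
    have h_defect := (defect_eq_zero_iff (x := (c, lineSlope v * c)) hv₁).2 rfl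
    exact ⟨(coordMetric_zero_eq_zero_iff hv hv₁ h_defect).2 hc, h_defect⟩

theorem defect_eq_iff_of_fst_ne_zero (hv : v.1 ≠ 0) :
    defect v x = -coordMetric 0 v v • x ↔
      ∃ d : Octonion, x = ((1 / ‖v.1‖ ^ 2) • (v.1 * star v.2 * d), d) := by
  simp only [← star_lineSlope_mul, defect_eq_iff hv]
  constructor
  · exact fun h => ⟨x.2, Prod.ext h rfl⟩
  · rintro ⟨d, rfl⟩
    rfl

theorem coordMetric_and_defect_eq_zero_iff_of_snd_ne_zero (hv : coordMetric 0 v v ≠ 0)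
    (hv₂ : v.2 ≠ 0) :
    coordMetric 0 v x = 0 ∧ defect v x = 0 ↔
      ∃ d : Octonion, inner ℝ d v.2 = 0 ∧ x = ((1 / ‖v.2‖ ^ 2) • (v.1 * star v.2 * d), d) := by
  have hv' : coordMetric 0 v.swap v.swap ≠ 0 := by rwa [coordMetric_zero_swap, neg_ne_zero]
  rw [← neg_eq_zero, ← coordMetric_zero_swap, ← defect_swap_eq_zero_iff,
    coordMetric_and_defect_eq_zero_iff_of_fst_ne_zero hv' hv₂]
  simp only [← Prod.swap_inj (p := x), Prod.fst_swap, Prod.snd_swap, Prod.swap_prod_mk]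

theorem defect_eq_iff_of_snd_ne_zero (hv : v.2 ≠ 0) :
    defect v x = -coordMetric 0 v v • x ↔
      ∃ c : Octonion, x = (c, (1 / ‖v.2‖ ^ 2) • (v.2 * star v.1 * c)) := by
  rw [← defect_swap_eq_iff, defect_eq_iff_of_fst_ne_zero (v := v.swap) hv]
  simp only [← Prod.swap_inj (p := x), Prod.fst_swap, Prod.snd_swap, Prod.swap_prod_mk]

theorem defect_self (v : Octonion × Octonion) : defect v v = 0 := by
  simp only [defect_apply, Octonion.mul_star_mul, sub_self]
  rfl

theorem fst_ne_zero_or_swap_fst_ne_zero (hv : v ≠ 0) : v.1 ≠ 0 ∨ v.swap.1 ≠ 0 := by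
  by_contra! h
  exact hv (Prod.ext h.1 h.2)

theorem defect_eq_zero_congr (hv : v ≠ 0) (hw : w ≠ 0) (h : defect v w = 0) :
    defect v x = 0 ↔ defect w x = 0 := by
  have h_of_fst {v w x : Octonion × Octonion} (hv : v.1 ≠ 0) (hw : w ≠ 0) (h : defect v w = 0) :
      defect v x = 0 ↔ defect w x = 0 := by
    rw [defect_eq_zero_iff hv] at h
    have hw₁ : w.1 ≠ 0 := fun hw₁ => hw (Prod.ext hw₁ (by rw [h, hw₁, mul_zero]; rfl))
    rw [defect_eq_zero_iff hv, defect_eq_zero_iff hw₁, lineSlope_eq_of_snd_eq hw₁ h]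
  rcases fst_ne_zero_or_swap_fst_ne_zero hv with hv₁ | hv₂
  · exact h_of_fst hv₁ hw h
  · rw [← defect_swap_eq_zero_iff, ← defect_swap_eq_zero_iff (v := w)]
    exact h_of_fst hv₂ (fun h₀ => hw (Prod.swap_injective h₀)) (defect_swap_eq_zero_iff.2 h)

theorem defect_eq_symm (hv : v ≠ 0) (h : defect v w = -coordMetric 0 v v • w) :
    defect w v = -coordMetric 0 w w • v := by
  have h_of_fst {v w : Octonion × Octonion} (hv : v.1 ≠ 0)
      (h : defect v w = -coordMetric 0 v v • w) : defect w v = -coordMetric 0 w w • v := by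
    rw [defect_eq_iff hv] at h
    by_cases hw₂ : w.2 = 0
    · obtain rfl : w = 0 := Prod.ext (by rw [h, hw₂, mul_zero]; rfl) hw₂
      simp [defect_apply]
    · rw [← defect_swap_eq_iff, defect_eq_iff (v := w.swap) hw₂,
        lineSlope_eq_of_snd_eq (v := w.swap) hw₂ h, star_star]
      exact (lineSlope_mul_fst hv).symm
  rcases fst_ne_zero_or_swap_fst_ne_zero hv with hv₁ | hv₂
  · exact h_of_fst hv₁ h
  · exact defect_swap_eq_iff.1 (h_of_fst hv₂ (defect_swap_eq_iff.2 h))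

theorem finrank_ker_defect (hv : v ≠ 0) :
    Module.finrank ℝ (LinearMap.ker (defect v)) = 8 := by
  have h_of_fst {v : Octonion × Octonion} (hv : v.1 ≠ 0) :
      Module.finrank ℝ (LinearMap.ker (defect v)) = 8 := by
    have h_graph : LinearMap.ker (defect v) =
        (Octonion.mulL (lineSlope v)).toLinearMap.graph :=
      Submodule.ext fun x => defect_eq_zero_iff hv
    rw [h_graph, LinearMap.graph_eq_range_prod, LinearMap.finrank_range_of_inj
      fun x y h => congrArg Prod.fst h, Octonion.finrank_eq]
  rcases fst_ne_zero_or_swap_fst_ne_zero hv with hv₁ | hv₂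
  · exact h_of_fst hv₁
  · have h_map : (LinearMap.ker (defect v)).map
        (LinearEquiv.prodComm ℝ Octonion Octonion : _ →ₗ[ℝ] _) =
          LinearMap.ker (defect v.swap) := by
      ext x
      rw [Submodule.mem_map_equiv]
      exact (defect_swap_eq_zero_iff (x := x.swap)).symm
    rw [← h_of_fst hv₂, ← h_map, LinearEquiv.finrank_map_eq]

theorem hasOssermanForm_zero (v : Octonion × Octonion) :
    HasOssermanForm (4 : ℝ) 1 (coordMetric 0 v).toLinearMap v (defect v)
      (coordJacobi coordMetric 0 v) where
  apply_eq x := by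
    rw [coordJacobi_zero]
    norm_num
  defect_self := defect_self v
  defect_defect x := by
    have h_mul (a b c : Octonion) : a * star b * (b * star a * c) = (‖a‖ ^ 2 * ‖b‖ ^ 2) • c := by
      have h := Octonion.mul_star_mul' (a * star b) c
      rwa [star_mul, star_star, norm_mul, norm_star, mul_pow] at h
    change _ = -coordMetric 0 v v • _
    rw [coordMetric_zero_self]
    simp only [defect_apply, mul_sub, mul_smul_comm, h_mul, Prod.smul_mk, Prod.mk.injEq]
    constructor <;> module
  form_defect x := by
    have h_inner (a b c : Octonion) : inner ℝ a (a * star b * c) = ‖a‖ ^ 2 * inner ℝ b c := by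
      rw [real_inner_comm, Octonion.inner_mul_left, star_mul, star_star, Octonion.mul_star_mul,
        real_inner_smul_right, real_inner_comm]
    change coordMetric 0 v (defect v x) = 0
    simp only [coordMetric_zero, defect_apply, inner_sub_right, real_inner_smul_right, h_inner]
    ring

end OP11

namespace OP11

open SemiRiemannian

/-! ### The metric and the Jacobi operators in charts -/

section Charts

variable {e e' : OpenPartialHomeomorph OP11 (Octonion × Octonion)} {p : OP11}
  {y : Octonion × Octonion}

theorem target_eq_domain (he : e ∈ atlas (Octonion × Octonion) OP11) : e.target = domain := by
  change e ∈ ({chart₁, chart₂} : Set _) at he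
  rcases he with rfl | rfl <;> rfl

theorem chartAt_self_mem_domain (p : OP11) : chartAt (Octonion × Octonion) p p ∈ domain :=
  target_eq_domain (chart_mem_atlas _ p) ▸ mem_chart_target _ p

theorem isLocalIsometryAt_coordChange (he : e ∈ atlas (Octonion × Octonion) OP11)
    (he' : e' ∈ atlas (Octonion × Octonion) OP11) (hy : y ∈ (e.symm ≫ₕ e').source) :
    IsLocalIsometryAt coordMetric coordMetric (e' ∘ e.symm) y := by
  have h_id (e : OpenPartialHomeomorph OP11 (Octonion × Octonion)) (hy : y ∈ e.target) :
      IsLocalIsometryAt coordMetric coordMetric (e ∘ e.symm) y :=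
    (IsLocalIsometryAt.refl coordMetric y).congr <| by
      filter_upwards [e.open_target.mem_nhds hy] with z hz using e.right_inv hz
  have h_transition (hy : y ∈ domain) (hy' : swapFun (coordInv₁ y) ∈ source₁) :
      IsLocalIsometryAt coordMetric coordMetric (coord₁ ∘ swapFun ∘ coordInv₁) y :=
    (isLocalIsometryAt_transition hy (fst_ne_zero_of_swapFun_mem hy hy')).congr <| by
      filter_upwards [isOpen_domain.mem_nhds hy] with z hz using coord₁_swapFun_coordInv₁ hz
  change e ∈ ({chart₁, chart₂} : Set _) at he
  change e' ∈ ({chart₁, chart₂} : Set _) at he'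
  rcases he with rfl | rfl <;> rcases he' with rfl | rfl
  · exact h_id _ hy.1
  · exact h_transition hy.1 hy.2
  · exact h_transition hy.1 hy.2
  · exact h_id _ hy.1

theorem mfderiv_chart (he : e ∈ atlas (Octonion × Octonion) OP11) (hp : p ∈ e.source) :
    mfderiv 𝓘(ℝ, Octonion × Octonion) 𝓘(ℝ, Octonion × Octonion) e p =
      fderiv ℝ (e ∘ (chartAt (Octonion × Octonion) p).symm)
        (chartAt (Octonion × Octonion) p p) := by
  refine (mdifferentiableAt_atlas he hp).mfderiv.trans ?_
  rw [modelWithCornersSelf_coe, Set.range_id, fderivWithin_univ]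
  rfl

theorem tangentCoordChange_eq_fderiv (p q : OP11) :
    tangentCoordChange 𝓘(ℝ, Octonion × Octonion) p q q =
      fderiv ℝ (chartAt (Octonion × Octonion) q ∘ (chartAt (Octonion × Octonion) p).symm)
        (chartAt (Octonion × Octonion) p q) := by
  rw [tangentCoordChange_def, modelWithCornersSelf_coe, Set.range_id, fderivWithin_univ]
  rfl

theorem metric_eq_coordMetric (he : e ∈ atlas (Octonion × Octonion) OP11) (hp : p ∈ e.source)
    (v w : TangentSpace 𝓘(ℝ, Octonion × Octonion) p) :
    metric p v w = coordMetric (e p)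
      (mfderiv 𝓘(ℝ, Octonion × Octonion) 𝓘(ℝ, Octonion × Octonion) e p v)
      (mfderiv 𝓘(ℝ, Octonion × Octonion) 𝓘(ℝ, Octonion × Octonion) e p w) := by
  set c := chartAt (Octonion × Octonion) p
  have h_left : c.symm (c p) = p := c.left_inv (mem_chart_source _ p)
  have hy : c p ∈ (c.symm ≫ₕ e).source := by
    refine ⟨mem_chart_target _ p, ?_⟩
    change c.symm (c p) ∈ e.source
    rwa [h_left]
  have h := (isLocalIsometryAt_coordChange (chart_mem_atlas _ p) he hy).apply_fderiv v w
  rw [Function.comp_apply, h_left] at h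
  rw [mfderiv_chart he hp]
  exact h.symm

theorem inChart_metric (p : OP11) : Set.EqOn (inChart metric p) coordMetric domain := by
  rw [← target_eq_domain (chart_mem_atlas (Octonion × Octonion) p)]
  intro y hy
  set c := chartAt (Octonion × Octonion) p
  have h_right : c (c.symm y) = y := c.right_inv hy
  have h := isLocalIsometryAt_coordChange (chart_mem_atlas _ p) (chart_mem_atlas _ (c.symm y))
    (y := y) ⟨hy, mem_chart_source _ _⟩
  have h_change := tangentCoordChange_eq_fderiv p (c.symm y)
  rw [h_right] at h_change
  refine ContinuousLinearMap.ext fun v => ContinuousLinearMap.ext fun w => ?_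
  rw [← h.apply_fderiv v w, ← h_change]
  rfl

theorem isMetric_metric : IsMetric metric where
  symm p v w := coordMetric_symm _ v w
  nondegenerate p v h := coordMetric_nondegenerate (chartAt_self_mem_domain p) v h
  smooth p := by
    rw [target_eq_domain (chart_mem_atlas (Octonion × Octonion) p)]
    exact contDiffOn_coordMetric.congr (inChart_metric p)

theorem jacobi_metric (p : OP11) (v : TangentSpace 𝓘(ℝ, Octonion × Octonion) p) :
    jacobi metric p v = coordJacobi coordMetric (chartAt (Octonion × Octonion) p p) v :=
  coordJacobi_congr ((inChart_metric p).eventuallyEq_of_mem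
    (isOpen_domain.mem_nhds (chartAt_self_mem_domain p))) v

end Charts

/-! ### Reduction to the origin of the affine plane -/

/-- The linear isomorphism `L` identifies the metric and the Jacobi operators at `p` with those at
the origin of the affine plane. -/
structure IsModel (p : OP11)
    (L : TangentSpace 𝓘(ℝ, Octonion × Octonion) p ≃ₗ[ℝ] Octonion × Octonion) : Prop where
  metric_eq : ∀ v w, metric p v w = coordMetric 0 (L v) (L w)
  jacobi_eq : ∀ v x, L (jacobi metric p v x) = coordJacobi coordMetric 0 (L v) (L x)

theorem exists_isModel (p : OP11) : ∃ L, IsModel p L := by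
  have hy := chartAt_self_mem_domain p
  obtain ⟨φ, hφ, h_zero⟩ := isLocallyIsometric_zero hy
  refine ⟨.ofBijective (fderiv ℝ φ (chartAt (Octonion × Octonion) p p)).toLinearMap
    ⟨hφ.fderiv_injective isMetricOn_coordMetric hy, hφ.fderiv_surjective isMetricOn_coordMetric hy⟩,
    fun v w => ?_, fun v x => ?_⟩
  · have h := hφ.apply_fderiv v w
    rw [h_zero] at h
    exact h.symm
  · have h := hφ.fderiv_coordJacobi isMetricOn_coordMetric hy isMetricOn_coordMetric
      (h_zero ▸ zero_mem_domain) v x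
    rw [h_zero] at h
    rw [jacobi_metric]
    exact h

theorem chartAt_basePoint_apply : chartAt (Octonion × Octonion) basePoint basePoint = 0 := by
  rw [chartAt_basePoint]
  exact chart₁_apply 0 0 ⟨rfl, by simp⟩

theorem isModel_basePoint : IsModel basePoint (LinearEquiv.refl ℝ (Octonion × Octonion)) where
  metric_eq v w := by
    rw [metric, chartAt_basePoint_apply]
    rfl
  jacobi_eq v x := by
    rw [jacobi_metric, chartAt_basePoint_apply]
    rfl

theorem tangentCoord_apply (v : TangentSpace 𝓘(ℝ, Octonion × Octonion) basePoint) :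
    tangentCoord v = v := by
  have h_id : chart₁ ∘ chart₁.symm =ᶠ[nhds (0 : Octonion × Octonion)] id := by
    filter_upwards [isOpen_domain.mem_nhds zero_mem_domain] with y hy
    exact chart₁.right_inv hy
  have h_source : basePoint ∈ chart₁.source := toPlane_mem_source₁.2 Octonion.one_ne_zero
  rw [tangentCoord, mfderiv_chart (Or.inl rfl) h_source, chartAt_basePoint_apply,
    chartAt_basePoint, h_id.fderiv_eq, fderiv_id]
  rfl

/-! ### The special Osserman property -/

theorem metric_self_ne_zero {p : OP11} {v : TangentSpace 𝓘(ℝ, Octonion × Octonion) p}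
    (hv : IsUnitVector metric p v) : metric p v v ≠ 0 := by
  rcases hv with h | h <;> rw [h] <;> norm_num

namespace IsModel

variable {p : OP11} {L : TangentSpace 𝓘(ℝ, Octonion × Octonion) p ≃ₗ[ℝ] Octonion × Octonion}
  {v w x : TangentSpace 𝓘(ℝ, Octonion × Octonion) p}

theorem hasOssermanForm (hL : IsModel p L) (v : TangentSpace 𝓘(ℝ, Octonion × Octonion) p) :
    HasOssermanForm 4 1 (metric p v).toLinearMap v (L.symm.conj (defect (L v)))
      (jacobi metric p v) where
  apply_eq x := L.injective <| by
    rw [hL.jacobi_eq, (hasOssermanForm_zero (L v)).apply_eq]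
    change _ = L ((4 : ℝ) • (metric p v v • x - metric p v x • v)
      + (4 - 1 : ℝ) • L.symm (defect (L v) (L x)))
    simp only [map_add, map_smul, map_sub, L.apply_symm_apply, hL.metric_eq]
    rfl
  defect_self := by
    change L.symm (defect (L v) (L v)) = 0
    rw [defect_self, map_zero]
  defect_defect x := by
    change L.symm (defect (L v) (L (L.symm (defect (L v) (L x))))) =
      -metric p v v • L.symm (defect (L v) (L x))
    rw [L.apply_symm_apply, (hasOssermanForm_zero (L v)).defect_defect, map_smul, hL.metric_eq]
    rfl
  form_defect x := by
    change metric p v (L.symm (defect (L v) (L x))) = 0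
    rw [hL.metric_eq, L.apply_symm_apply]
    exact (hasOssermanForm_zero (L v)).form_defect (L x)

theorem apply_ne_zero (hL : IsModel p L) (hv : metric p v v ≠ 0) : L v ≠ 0 := fun h =>
  hv (by rw [hL.metric_eq, h, map_zero])

theorem conj_defect_eq_zero_iff : L.symm.conj (defect (L v)) x = 0 ↔ defect (L v) (L x) = 0 :=
  L.symm.map_eq_zero_iff

theorem conj_defect_eq_iff (hL : IsModel p L) :
    L.symm.conj (defect (L v)) x = -metric p v v • x ↔
      defect (L v) (L x) = -coordMetric 0 (L v) (L v) • L x := by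
  rw [← L.injective.eq_iff, map_smul, hL.metric_eq]
  change L (L.symm _) = _ ↔ _
  rw [L.apply_symm_apply]
  rfl

theorem mem_jacobiEigenspace_four_iff (hL : IsModel p L) (hv : metric p v v ≠ 0) :
    x ∈ jacobiEigenspace metric p v 4 ↔
      coordMetric 0 (L v) (L x) = 0 ∧ defect (L v) (L x) = 0 := by
  refine ((hL.hasOssermanForm v).mem_ker_left_iff hv (by norm_num) (by norm_num)).trans ?_
  rw [conj_defect_eq_zero_iff, ← hL.metric_eq]
  rfl

theorem mem_jacobiEigenspace_one_iff (hL : IsModel p L) (hv : metric p v v ≠ 0) :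
    x ∈ jacobiEigenspace metric p v 1 ↔
      defect (L v) (L x) = -coordMetric 0 (L v) (L v) • L x :=
  ((hL.hasOssermanForm v).mem_ker_right_iff hv (by norm_num) (by norm_num)).trans
    hL.conj_defect_eq_iff

theorem mem_extendedEigenspace_four_iff (hL : IsModel p L) (hv : metric p v v ≠ 0) :
    x ∈ extendedEigenspace metric p v 4 ↔ defect (L v) (L x) = 0 := by
  rw [extendedEigenspace]
  change x ∈ Submodule.span ℝ {v} ⊔
    LinearMap.ker (jacobi metric p v - ((metric p v).toLinearMap v * 4) • LinearMap.id) ↔ _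
  rw [(hL.hasOssermanForm v).span_sup_ker_left hv (by norm_num) (by norm_num), LinearMap.mem_ker,
    conj_defect_eq_zero_iff]

theorem finrank_ker_conj_defect (hL : IsModel p L) (hv : metric p v v ≠ 0) :
    Module.finrank ℝ (LinearMap.ker (L.symm.conj (defect (L v)))) = 8 := by
  have h_map : (LinearMap.ker (L.symm.conj (defect (L v)))).map (L : _ →ₗ[ℝ] _) =
      LinearMap.ker (defect (L v)) := by
    ext x
    rw [Submodule.mem_map_equiv, LinearMap.mem_ker, conj_defect_eq_zero_iff, L.apply_symm_apply,
      LinearMap.mem_ker]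
  rw [← finrank_ker_defect (hL.apply_ne_zero hv), ← h_map, LinearEquiv.finrank_map_eq]

theorem finrank_jacobiEigenspace (hL : IsModel p L) (hv : metric p v v ≠ 0) :
    Module.finrank ℝ (jacobiEigenspace metric p v 4) = 7 ∧
      Module.finrank ℝ (jacobiEigenspace metric p v 1) = 8 := by
  have : Module.Finite ℝ (TangentSpace 𝓘(ℝ, Octonion × Octonion) p) := Module.Finite.equiv L.symm
  have h_left : Module.finrank ℝ (jacobiEigenspace metric p v 4) + 1 = _ :=
    (hL.hasOssermanForm v).finrank_ker_left hv (by norm_num) (by norm_num)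
  have h_right : Module.finrank ℝ (jacobiEigenspace metric p v 1) + _ = _ :=
    (hL.hasOssermanForm v).finrank_ker_right hv (by norm_num) (by norm_num)
  rw [hL.finrank_ker_conj_defect hv] at h_left h_right
  rw [L.finrank_eq, Module.finrank_prod, Octonion.finrank_eq] at h_right
  omega

theorem condition_I (hL : IsModel p L) (hv : metric p v v ≠ 0) :
    ∃ h : ∀ x ∈ perp metric p v, jacobi metric p v x ∈ perp metric p v,
      ⨆ t : ℝ, Module.End.eigenspace ((jacobi metric p v).restrict h) t = ⊤ ∧
      {t : ℝ | t ≠ 0 ∧ Module.End.HasEigenvalue ((jacobi metric p v).restrict h) t} =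
        {metric p v v * 4, metric p v v * 1} := by
  have h_form := hL.hasOssermanForm v
  have h_perp : ∀ x ∈ perp metric p v, jacobi metric p v x ∈ perp metric p v :=
    fun x _ => h_form.form_apply x
  have ⟨h_four, h_one⟩ := hL.finrank_jacobiEigenspace hv
  have h_ne {t : ℝ} {n : ℕ} (h : Module.finrank ℝ (jacobiEigenspace metric p v t) = n + 1) :
      jacobiEigenspace metric p v t ≠ ⊥ := fun h_bot => by
    rw [h_bot, finrank_bot] at h
    omega
  exact ⟨h_perp, h_form.iSup_eigenspace_restrict hv (by norm_num) (by norm_num) (by norm_num) _,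
    h_form.setOf_hasEigenvalue_restrict hv (by norm_num) (by norm_num) h_perp (h_ne h_four)
      (h_ne h_one)⟩

theorem extendedEigenspace_four_eq (hL : IsModel p L) (hv : metric p v v ≠ 0)
    (hw : metric p w w ≠ 0) (h : w ∈ extendedEigenspace metric p v 4) :
    extendedEigenspace metric p v 4 = extendedEigenspace metric p w 4 := by
  rw [hL.mem_extendedEigenspace_four_iff hv] at h
  ext x
  rw [hL.mem_extendedEigenspace_four_iff hv, hL.mem_extendedEigenspace_four_iff hw]
  exact defect_eq_zero_congr (hL.apply_ne_zero hv) (hL.apply_ne_zero hw) h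

theorem mem_jacobiEigenspace_one_symm (hL : IsModel p L) (hv : metric p v v ≠ 0)
    (h : w ∈ jacobiEigenspace metric p v 1) : v ∈ jacobiEigenspace metric p w 1 := by
  rw [hL.mem_jacobiEigenspace_one_iff hv] at h
  have h_form : metric p w v = 0 := by
    rw [isMetric_metric.symm]
    exact (hL.hasOssermanForm v).form_eq_zero_of_defect_eq hv (hL.conj_defect_eq_iff.2 h)
  exact (hL.hasOssermanForm w).mem_ker_right_of_defect_eq h_form
    (hL.conj_defect_eq_iff.2 (defect_eq_symm (hL.apply_ne_zero hv) h))

theorem sigPos_and_sigNeg (hL : IsModel p L) :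
    sigPos (LinearMap.BilinMap.toQuadraticMap (metric p).toBilinForm) = 8 ∧
      sigNeg (LinearMap.BilinMap.toQuadraticMap (metric p).toBilinForm) = 8 := by
  have : Module.Finite ℝ (TangentSpace 𝓘(ℝ, Octonion × Octonion) p) := Module.Finite.equiv L.symm
  rw [← Octonion.finrank_eq]
  exact sigPos_and_sigNeg_of_eq_norm_sq_sub_norm_sq L fun v =>
    (hL.metric_eq v v).trans (coordMetric_zero_self (L v))

end IsModel

theorem hasSignature_metric : HasSignature metric 8 8 := fun p =>
  have ⟨_, hL⟩ := exists_isModel p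
  hL.sigPos_and_sigNeg

theorem finrank_jacobiEigenspace {p : OP11} {v : TangentSpace 𝓘(ℝ, Octonion × Octonion) p}
    (hv : metric p v v ≠ 0) :
    Module.finrank ℝ (jacobiEigenspace metric p v 4) = 7 ∧
      Module.finrank ℝ (jacobiEigenspace metric p v 1) = 8 :=
  have ⟨_, hL⟩ := exists_isModel p
  hL.finrank_jacobiEigenspace hv

theorem isSpecialOsserman_metric : IsSpecialOssermanWith metric 4 1 where
  isMetric := isMetric_metric
  left_ne_zero := by norm_num
  right_ne_zero := by norm_num
  ne := by norm_num
  condition_I p v hv :=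
    have ⟨_, hL⟩ := exists_isModel p
    hL.condition_I (metric_self_ne_zero hv)
  condition_II p v w hv hw h :=
    have ⟨_, hL⟩ := exists_isModel p
    hL.extendedEigenspace_four_eq (metric_self_ne_zero hv) (metric_self_ne_zero hw) h
  condition_III p v w hv h :=
    have ⟨_, hL⟩ := exists_isModel p
    hL.mem_jacobiEigenspace_one_symm (metric_self_ne_zero hv) h

/-! ### The eigenspaces at the base point -/

section BasePoint

variable {v x : TangentSpace 𝓘(ℝ, Octonion × Octonion) basePoint} {a b : Octonion}

theorem mem_jacobiEigenspace_basePoint_four_iff (hv : metric basePoint v v ≠ 0) :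
    x ∈ jacobiEigenspace metric basePoint v 4 ↔
      coordMetric 0 (tangentCoord v) (tangentCoord x) = 0 ∧
        defect (tangentCoord v) (tangentCoord x) = 0 := by
  rw [tangentCoord_apply, tangentCoord_apply]
  exact isModel_basePoint.mem_jacobiEigenspace_four_iff hv

theorem mem_jacobiEigenspace_basePoint_one_iff (hv : metric basePoint v v ≠ 0) :
    x ∈ jacobiEigenspace metric basePoint v 1 ↔
      defect (tangentCoord v) (tangentCoord x) =
        -coordMetric 0 (tangentCoord v) (tangentCoord v) • tangentCoord x := by
  rw [tangentCoord_apply, tangentCoord_apply]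
  exact isModel_basePoint.mem_jacobiEigenspace_one_iff hv

theorem coordMetric_tangentCoord_ne_zero (hv : metric basePoint v v ≠ 0) :
    coordMetric 0 (tangentCoord v) (tangentCoord v) ≠ 0 := by
  rw [tangentCoord_apply]
  exact isModel_basePoint.metric_eq v v ▸ hv

theorem jacobiEigenspace_basePoint_four_of_fst_ne_zero (hv : metric basePoint v v ≠ 0)
    (hab : tangentCoord v = (a, b)) (ha : a ≠ 0) :
    (jacobiEigenspace metric basePoint v 4 : Set _) = tangentCoord ⁻¹'
      {x | ∃ c : Octonion, inner ℝ c a = 0 ∧ x = (c, (1 / ‖a‖ ^ 2) • (b * star a * c))} := by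
  ext x
  rw [SetLike.mem_coe, mem_jacobiEigenspace_basePoint_four_iff hv, hab]
  exact coordMetric_and_defect_eq_zero_iff_of_fst_ne_zero
    (hab ▸ coordMetric_tangentCoord_ne_zero hv) ha

theorem jacobiEigenspace_basePoint_one_of_fst_ne_zero (hv : metric basePoint v v ≠ 0)
    (hab : tangentCoord v = (a, b)) (ha : a ≠ 0) :
    (jacobiEigenspace metric basePoint v 1 : Set _) = tangentCoord ⁻¹'
      {x | ∃ d : Octonion, x = ((1 / ‖a‖ ^ 2) • (a * star b * d), d)} := by
  ext x
  rw [SetLike.mem_coe, mem_jacobiEigenspace_basePoint_one_iff hv, hab]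
  exact defect_eq_iff_of_fst_ne_zero ha

theorem jacobiEigenspace_basePoint_four_of_snd_ne_zero (hv : metric basePoint v v ≠ 0)
    (hab : tangentCoord v = (a, b)) (hb : b ≠ 0) :
    (jacobiEigenspace metric basePoint v 4 : Set _) = tangentCoord ⁻¹'
      {x | ∃ d : Octonion, inner ℝ d b = 0 ∧ x = ((1 / ‖b‖ ^ 2) • (a * star b * d), d)} := by
  ext x
  rw [SetLike.mem_coe, mem_jacobiEigenspace_basePoint_four_iff hv, hab]
  exact coordMetric_and_defect_eq_zero_iff_of_snd_ne_zero
    (hab ▸ coordMetric_tangentCoord_ne_zero hv) hb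

theorem jacobiEigenspace_basePoint_one_of_snd_ne_zero (hv : metric basePoint v v ≠ 0)
    (hab : tangentCoord v = (a, b)) (hb : b ≠ 0) :
    (jacobiEigenspace metric basePoint v 1 : Set _) = tangentCoord ⁻¹'
      {x | ∃ c : Octonion, x = (c, (1 / ‖b‖ ^ 2) • (b * star a * c))} := by
  ext x
  rw [SetLike.mem_coe, mem_jacobiEigenspace_basePoint_one_iff hv, hab]
  exact defect_eq_iff_of_snd_ne_zero hb

end BasePoint

end OP11

theorem mainTheorem4 :
    -- in each of the two charts the metric is given by the defining formula
    (∀ e ∈ atlas (Octonion × Octonion) OP11, ∀ p ∈ e.source,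
      ∀ v w : TangentSpace 𝓘(ℝ, Octonion × Octonion) p,
        OP11.metric p v w = OP11.coordMetric (e p)
          (mfderiv 𝓘(ℝ, Octonion × Octonion) 𝓘(ℝ, Octonion × Octonion) e p v)
          (mfderiv 𝓘(ℝ, Octonion × Octonion) 𝓘(ℝ, Octonion × Octonion) e p w)) ∧
    SemiRiemannian.HasSignature OP11.metric 8 8 ∧
    -- the special Osserman conditions hold at every point
    SemiRiemannian.IsSpecialOssermanWith OP11.metric 4 1 ∧
    -- multiplicities of the eigenvalues
    (∀ (p : OP11) (v : TangentSpace 𝓘(ℝ, Octonion × Octonion) p),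
      SemiRiemannian.IsUnitVector OP11.metric p v →
        Module.finrank ℝ (SemiRiemannian.jacobiEigenspace OP11.metric p v 4) = 7 ∧
        Module.finrank ℝ (SemiRiemannian.jacobiEigenspace OP11.metric p v 1) = 8) ∧
    -- the eigenspaces at the point `[1, 0, 0]`
    (∀ (v : TangentSpace 𝓘(ℝ, Octonion × Octonion) OP11.basePoint) (a b : Octonion),
      SemiRiemannian.IsUnitVector OP11.metric OP11.basePoint v → OP11.tangentCoord v = (a, b) →
      (a ≠ 0 →
        (SemiRiemannian.jacobiEigenspace OP11.metric OP11.basePoint v 4 : Set _) =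
          OP11.tangentCoord ⁻¹'
            {x | ∃ c : Octonion, inner ℝ c a = 0 ∧ x = (c, (1 / ‖a‖ ^ 2) • ((b * star a) * c))} ∧
        (SemiRiemannian.jacobiEigenspace OP11.metric OP11.basePoint v 1 : Set _) =
          OP11.tangentCoord ⁻¹'
            {x | ∃ d : Octonion, x = ((1 / ‖a‖ ^ 2) • ((a * star b) * d), d)}) ∧
      (b ≠ 0 →
        (SemiRiemannian.jacobiEigenspace OP11.metric OP11.basePoint v 4 : Set _) =
          OP11.tangentCoord ⁻¹'
            {x | ∃ d : Octonion, inner ℝ d b = 0 ∧ x = ((1 / ‖b‖ ^ 2) • ((a * star b) * d), d)} ∧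
        (SemiRiemannian.jacobiEigenspace OP11.metric OP11.basePoint v 1 : Set _) =
          OP11.tangentCoord ⁻¹'
            {x | ∃ c : Octonion, x = (c, (1 / ‖b‖ ^ 2) • ((b * star a) * c))})) := by
  exact ⟨fun e he p hp v w => OP11.metric_eq_coordMetric he hp v w, OP11.hasSignature_metric,
    OP11.isSpecialOsserman_metric,
    fun p v hv => OP11.finrank_jacobiEigenspace (OP11.metric_self_ne_zero hv),
    fun v a b hv hab =>
      have hv₀ := OP11.metric_self_ne_zero hv
      ⟨fun ha => ⟨OP11.jacobiEigenspace_basePoint_four_of_fst_ne_zero hv₀ hab ha,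
        OP11.jacobiEigenspace_basePoint_one_of_fst_ne_zero hv₀ hab ha⟩,
      fun hb => ⟨OP11.jacobiEigenspace_basePoint_four_of_snd_ne_zero hv₀ hab hb,
        OP11.jacobiEigenspace_basePoint_one_of_snd_ne_zero hv₀ hab hb⟩⟩⟩
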